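/- **Setting.** Let $p>q>0$ be coprime integers, $p\ge 3$, and let $k$ be an integer not divisible by $p$. The lens space $L(p,q)$ is obtained from the $p$-gonal bipyramid with cone vertices $C_0,C_1$ and rim vertices $B_j$ ($j\in\mathbb Z/p$) by gluing, for every $i$, the face $B_iC_0B_{i+1}$ to the face $B_{i+q}C_1B_{i+q+1}$ (vertices in this order). Joining $C_0$ and $C_1$ by an edge decomposes $L(p,q)$ into the $p$ tetrahedra $C_0C_1B_iB_{i+1}$, with $p+2$ edges $$a=B_jB_{j+1},\qquad b_j=C_0B_j=C_1B_{j+q}\ (j\in\mathbb Z/p),\qquad c=C_0C_1 .$$ Let $\varphi\colon\pi_1(L(p,q))\to E_3$ be the homomorphism to the group of motions of $\mathbb R^3$ that sends the class of the edge $a$ to the rotation through $2\pi k/p$ about the $z$-axis. Map the vertices of the universal covering $\varphi$-equivariantly to $\mathbb R^3$, so that in cylindrical coordinates $$B_j=\bigl(\rho,\tfrac{2\pi jk}{p},0\bigr),\qquad C_j=\bigl(\sigma,\alpha+\tfrac{2\pi qjk}{p},s\bigr),\qquad \rho,\sigma>0,\ \alpha,s\in\mathbb R .$$ Let $l_e$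 be the resulting length of the edge $e$, and let $6V_i=\overrightarrow{C_0C_1}\cdot(\overrightarrow{C_0B_{i+1}}\times\overrightarrow{C_0B_i})$. For edge lengths near $(l_e)$ let the defect angle $\omega_e$ be minus the sum of the dihedral angles at $e$ (over all occurrences of $e$ in tetrahedra), those in the $i$-th tetrahedron taken with the fixed sign of $V_i$; dihedral angles are functions of the six edge lengths of a tetrahedron. Put $$F=\Bigl(\frac1{l_el_{e'}}\frac{\partial\omega_e}{\partial l_{e'}}\Bigr)_{e,e'},\qquad \mathcal C=\{b_1,\dots,b_{p-2}\},\qquad \overline{\mathcal C}=\{a,b_0,b_{p-1},c\},$$ with the partial derivatives taken at the lengths $(l_e)$, and let $F|_{\mathcal C}$ be the diagonal submatrix of $F$ with rows and columns in $\mathcal C$. Let $D$ be the set of $(\rho,\sigma,s,\alpha)$ with $\rho,\sigma>0$ such that all $V_i\neq0$ and $\det(F|_{\mathcal C})\ne0$, i.e. where the form below is defined. **Proposition.** $D$ is dense in $\{\rho>0,\ \sigma>0\}$, and there is exactly one constant $I_k>0$, independent of $(\rho,\sigma,s,\alpha)$, such that at every point of $D$ $$\left|\frac{\bigwedge_{e\in\overline{\mathcal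 C}} l_e\,dl_e}{\sqrt{\bigl|\det(F|_{\mathcal C})\prod_{i\in\mathbb Z/p}6V_i\bigr|}}\right| \;=\; \bigl|\,I_k\;\rho\,d\rho\wedge\sigma\,d\sigma\wedge ds\wedge d\alpha\,\bigr| .$$ (This constant is the invariant $I_k$ of the pair $(L(p,q),\varphi)$.) -/

import Mathlib

noncomputable section

namespace LensForm

open Real

/-! ### The bipyramid and its pre-triangulation of `L(p,q)`

The `p`-gonal bipyramid has cone vertices `C₀`, `C₁` and rim vertices `B_j`, `j ∈ ℤ/p`.  The edge
`C₀C₁` cuts it into the `p` tetrahedra `T_i = C₀ C₁ B_i B_{i+1}`. -/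

/-- Edges of the subdivided bipyramid: `axis = C₀C₁`, `upper j = C₀B_j`, `lower j = C₁B_j`,
`rim j = B_jB_{j+1}` (oriented from the first to the second vertex). -/
inductive BipEdge (p : ℕ) : Type
  | axis : BipEdge p
  | upper (j : ZMod p) : BipEdge p
  | lower (j : ZMod p) : BipEdge p
  | rim (j : ZMod p) : BipEdge p

/-- The edges `C₀B_i`, `B_iB_{i+1}`, `C₀B_{i+1}` of the face `B_i C₀ B_{i+1}`. -/
def upperFace {p : ℕ} (i : ZMod p) : Fin 3 → BipEdge p :=
  ![BipEdge.upper i, BipEdge.rim i, BipEdge.upper (i + 1)]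

/-- The edges `C₁B_i`, `B_iB_{i+1}`, `C₁B_{i+1}` of the face `B_i C₁ B_{i+1}`. -/
def lowerFace {p : ℕ} (i : ZMod p) : Fin 3 → BipEdge p :=
  ![BipEdge.lower i, BipEdge.rim i, BipEdge.lower (i + 1)]

/-- Identifications of edges produced by gluing, for each `i`, the face `B_i C₀ B_{i+1}` to the
face `B_{i+q} C₁ B_{i+q+1}`, vertices in the order in which they are written. -/
def Glued {p : ℕ} (q : ℕ) (e e' : BipEdge p) : Prop :=
  ∃ (i : ZMod p) (m : Fin 3), e = upperFace i m ∧ e' = lowerFace (i + (q : ZMod p)) m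

/-- The `p + 2` edges of the pre-triangulation of `L(p,q)`:
`a = B_jB_{j+1}`, `b j = C₀B_j = C₁B_{j+q}`, `c = C₀C₁`. -/
inductive Edge (p : ℕ) : Type
  | a : Edge p
  | b (j : ZMod p) : Edge p
  | c : Edge p
  deriving DecidableEq

/-- The edge of `L(p,q)` onto which an edge of the bipyramid is projected. -/
def edgeClass {p : ℕ} (q : ℕ) : BipEdge p → Edge p
  | BipEdge.axis => Edge.c
  | BipEdge.upper j => Edge.b j
  | BipEdge.lower j => Edge.b (j - q)
  | BipEdge.rim _ => Edge.a

/-- `edgeClass` is exactly the quotient by the gluing. -/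
theorem edgeClass_eq_iff {p q : ℕ} [NeZero p] (hpq : p.Coprime q) (e e' : BipEdge p) :
    edgeClass q e = edgeClass q e' ↔ Relation.EqvGen (Glued q) e e' := by
  have hrim1 : ∀ i : ZMod p,
      Relation.EqvGen (Glued q) (BipEdge.rim i) (BipEdge.rim (i + q)) := fun i =>
    Relation.EqvGen.rel _ _ ⟨i, 1, rfl, rfl⟩
  have hside : ∀ i : ZMod p,
      Relation.EqvGen (Glued q) (BipEdge.upper i) (BipEdge.lower (i + q)) := fun i =>
    Relation.EqvGen.rel _ _ ⟨i, 0, rfl, rfl⟩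
  have hside' : ∀ i : ZMod p,
      Relation.EqvGen (Glued q) (BipEdge.upper (i - (q : ZMod p))) (BipEdge.lower i) := fun i => by
    have h := hside (i - q)
    rwa [sub_add_cancel] at h
  have hrimn : ∀ (n : ℕ) (i : ZMod p),
      Relation.EqvGen (Glued q) (BipEdge.rim i) (BipEdge.rim (i + n * q)) := by
    intro n
    induction n with
    | zero => intro i; simpa using Relation.EqvGen.refl _
    | succ n ih =>
      intro i
      refine (ih i).trans _ _ _ ?_
      have h := hrim1 (i + n * q)
      have h2 : i + ((n + 1 : ℕ) : ZMod p) * q = i + n * q + q := by push_cast; ring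
      rwa [h2]
  have hrim : ∀ i j : ZMod p, Relation.EqvGen (Glued q) (BipEdge.rim i) (BipEdge.rim j) := by
    intro i j
    have h := hrimn ((j - i) * (q : ZMod p)⁻¹).val i
    have h2 : i + ((((j - i) * (q : ZMod p)⁻¹).val : ℕ) : ZMod p) * q = j := by
      rw [ZMod.natCast_val, ZMod.cast_id, mul_assoc, mul_comm _ (q : ZMod p),
        ZMod.coe_mul_inv_eq_one q hpq.symm]
      ring
    rwa [h2] at h
  constructor
  · cases e <;> cases e' <;> intro h <;> simp only [edgeClass, Edge.b.injEq, reduceCtorEq] at h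
    · exact Relation.EqvGen.refl _
    · subst h; exact Relation.EqvGen.refl _
    · subst h; exact hside' _
    · subst h; exact (hside' _).symm
    · have h := sub_left_injective h
      subst h; exact Relation.EqvGen.refl _
    · exact hrim _ _
  · intro h
    induction h with
    | rel x y h =>
      obtain ⟨i, m, rfl, rfl⟩ := h
      fin_cases m <;> simp [upperFace, lowerFace, edgeClass]
      ring
    | refl x => rfl
    | symm x y _ ih => exact ih.symm
    | trans x y z _ _ ih1 ih2 => exact ih1.trans ih2

/-- The six edges of `T_i`, whose vertices are numbered `0 = C₀, 1 = C₁, 2 = B_i, 3 = B_{i+1}`, in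
the order `01, 02, 03, 12, 13, 23`. -/
def tetEdge {p : ℕ} (i : ZMod p) : Fin 6 → BipEdge p :=
  ![BipEdge.axis, BipEdge.upper i, BipEdge.upper (i + 1), BipEdge.lower i, BipEdge.lower (i + 1),
    BipEdge.rim i]

/-- The edges of `L(p,q)` to which the six edges of `T_i` belong. -/
def tetLabel {p : ℕ} (q : ℕ) (i : ZMod p) (n : Fin 6) : Edge p := edgeClass q (tetEdge i n)

/-! ### Fundamental group and universal covering -/

/-- The two vertices of the pre-triangulation of `L(p,q)`. -/
inductive Vtx : Type
  | B : Vtx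
  | C : Vtx

/-- Initial vertex of an oriented edge. -/
def Edge.src {p : ℕ} : Edge p → Vtx
  | Edge.a => Vtx.B
  | Edge.b _ => Vtx.C
  | Edge.c => Vtx.C

/-- Final vertex of an oriented edge. -/
def Edge.tgt {p : ℕ} : Edge p → Vtx
  | Edge.a => Vtx.B
  | Edge.b _ => Vtx.B
  | Edge.c => Vtx.C

/-- For the face `xyz` of a tetrahedron (`x < y < z`), the positions of `xy`, `yz`, `xz` in the
list of edges `01, 02, 03, 12, 13, 23`. -/
def faceEdges : Fin 4 → Fin 6 × Fin 6 × Fin 6 :=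
  ![(0, 3, 1), (0, 4, 2), (1, 5, 2), (3, 5, 4)]

/-- Relators of the edge-path group: the edge `b 0`, which is a spanning tree of the 1-skeleton,
is trivial, and so is the boundary path `xy · yz · xz⁻¹` of every 2-simplex `xyz`. -/
def relators (p q : ℕ) : Set (FreeGroup (Edge p)) :=
  {r | r = FreeGroup.of (Edge.b 0) ∨ ∃ (i : ZMod p) (m : Fin 4),
    r = FreeGroup.of (tetLabel q i (faceEdges m).1) *
        FreeGroup.of (tetLabel q i (faceEdges m).2.1) *
        (FreeGroup.of (tetLabel q i (faceEdges m).2.2))⁻¹}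

/-- The fundamental group of `L(p,q)`, as the edge-path group of its pre-triangulation. -/
abbrev Pi1 (p q : ℕ) : Type := PresentedGroup (relators p q)

/-- The element of the fundamental group given by an oriented edge (closed up in the spanning
tree). -/
def edgePath {p : ℕ} (q : ℕ) (e : Edge p) : Pi1 p q := PresentedGroup.of e

/-- Euclidean space `ℝ³`. -/
abbrev Space : Type := EuclideanSpace ℝ (Fin 3)

/-- The group of motions of `ℝ³`. -/
abbrev E3 : Type := Space ≃ᵢ Space

/-- Rotation through the angle `t` about the `z`-axis, as a map. -/
def rotZFun (t : ℝ) (P : Space) : Space :=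
  !₂[cos t * P 0 - sin t * P 1, sin t * P 0 + cos t * P 1, P 2]

theorem rotZFun_rotZFun (s t : ℝ) (P : Space) : rotZFun s (rotZFun t P) = rotZFun (s + t) P := by
  ext n
  fin_cases n <;> simp [rotZFun, cos_add, sin_add] <;> ring

theorem rotZFun_zero (P : Space) : rotZFun 0 P = P := by
  ext n
  fin_cases n <;> simp [rotZFun]

theorem isometry_rotZFun (t : ℝ) : Isometry (rotZFun t) := by
  refine Isometry.of_dist_eq fun P Q => ?_
  simp only [EuclideanSpace.dist_eq, Fin.sum_univ_three, Real.dist_eq, sq_abs]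
  congr 1
  simp [rotZFun]
  linear_combination ((P 0 - Q 0) ^ 2 + (P 1 - Q 1) ^ 2) * sin_sq_add_cos_sq t

/-- Rotation through the angle `t` about the `z`-axis. -/
def rotZ (t : ℝ) : E3 where
  toFun := rotZFun t
  invFun := rotZFun (-t)
  left_inv P := by rw [rotZFun_rotZFun, neg_add_cancel, rotZFun_zero]
  right_inv P := by rw [rotZFun_rotZFun, add_neg_cancel, rotZFun_zero]
  isometry_toFun := isometry_rotZFun t

theorem rotZ_pow (t : ℝ) (n : ℕ) : rotZ t ^ n = rotZ (n * t) := by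
  induction n with
  | zero => ext1 P; exact (by simp [rotZ, rotZFun_zero] : P = rotZ ((0 : ℕ) * t) P)
  | succ n ih =>
    rw [pow_succ, ih]
    ext1 P
    change rotZFun _ (rotZFun _ P) = rotZFun _ P
    rw [rotZFun_rotZFun]
    push_cast
    ring_nf

/-- For every integer `k` there is a homomorphism that sends the generator `a` to the rotation
through `2πk/p`. -/
theorem exists_hom (p q : ℕ) [NeZero p] (k : ℤ) :
    ∃ φ : Pi1 p q →* E3, φ (edgePath q Edge.a) = rotZ (2 * π * k / p) := by
  let g : Edge p → Multiplicative (ZMod p)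
    | Edge.a => Multiplicative.ofAdd 1
    | Edge.b j => Multiplicative.ofAdd j
    | Edge.c => Multiplicative.ofAdd (q : ZMod p)
  have hg : ∀ r ∈ relators p q, FreeGroup.lift g r = 1 := by
    rintro r (rfl | ⟨i, m, rfl⟩)
    · simp [g]
    · simp only [map_mul, map_inv, FreeGroup.lift_apply_of, mul_inv_eq_one]
      fin_cases m <;>
        simp only [g, faceEdges, tetLabel, tetEdge, edgeClass, ← ofAdd_add, Fin.isValue,
          Matrix.cons_val, Fin.mk_zero', Fin.mk_one, Fin.reduceFinMk] <;>
        congr 1 <;> ring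
  let R : Additive E3 := Additive.ofMul (rotZ (2 * π * k / p))
  have hR : zmultiplesHom (Additive E3) R (p : ℤ) = 0 := by
    have hp : (p : ℝ) ≠ 0 := Nat.cast_ne_zero.mpr (NeZero.ne p)
    have h : rotZ (2 * π * k / p) ^ p = 1 := by
      rw [rotZ_pow, mul_div_cancel₀ _ hp]
      ext1 P
      change rotZFun _ P = P
      have h1 : 2 * π * (k : ℝ) = k * (2 * π) := by ring
      ext n
      have h2 : sin ((k : ℝ) * (2 * π)) = 0 := by simpa using sin_add_int_mul_two_pi 0 k
      fin_cases n <;> simp [rotZFun, h1, h2, cos_int_mul_two_pi]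
    simpa [R] using congrArg Additive.ofMul h
  refine ⟨(AddMonoidHom.toMultiplicativeLeft (ZMod.lift p ⟨zmultiplesHom _ R, hR⟩)).comp
    (PresentedGroup.toGroup hg), ?_⟩
  have h1 := ZMod.lift_coe p ⟨zmultiplesHom _ R, hR⟩ 1
  simp only [Int.cast_one] at h1
  simp [edgePath, g, h1, R]

/-- The parameters `(ρ, σ, s, α)`. -/
abbrev Param : Type := Fin 4 → ℝ

/-- The images of `B₀` and `C₀`, with cylindrical coordinates `(ρ, 0, 0)` and `(σ, α, s)`. -/
def basePoint (x : Param) : Vtx → Space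
  | Vtx.B => !₂[x 0, 0, 0]
  | Vtx.C => !₂[x 1 * cos (x 3), x 1 * sin (x 3), x 2]

/-- The `φ`-equivariant map from the vertices of the universal covering to `ℝ³`.  The vertices over
`v` are the pairs `(g, v)`, `g ∈ π₁`; the lifts of an edge `e` go from `(g, e.src)` to
`(g [e], e.tgt)`; the lift of the bipyramid that starts at `C₀ = (1, C)` has `C₁ = ([c], C)` and
`B_j = ([b j], B)`. -/
def develop {p q : ℕ} (φ : Pi1 p q →* E3) (x : Param) (g : Pi1 p q) (v : Vtx) : Space :=
  φ g (basePoint x v)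

/-- Images of the vertices `C₀, C₁, B_i, B_{i+1}` of (a lift of) `T_i`. -/
def tetPoint {p q : ℕ} (φ : Pi1 p q →* E3) (x : Param) (i : ZMod p) : Fin 4 → Space :=
  ![develop φ x 1 Vtx.C, develop φ x (edgePath q Edge.c) Vtx.C,
    develop φ x (edgePath q (Edge.b i)) Vtx.B, develop φ x (edgePath q (Edge.b (i + 1))) Vtx.B]

/-- Length of an edge, computed from one of its lifts. -/
def edgeLength {p q : ℕ} (φ : Pi1 p q →* E3) (x : Param) (e : Edge p) : ℝ :=
  dist (develop φ x 1 e.src) (develop φ x (edgePath q e) e.tgt)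

/-- The triple product `6 V` of the vectors `PQ`, `PR`, `PS`. -/
def tripleProduct (P Q R S : Space) : ℝ :=
  Matrix.det !![(Q - P) 0, (Q - P) 1, (Q - P) 2;
                (R - P) 0, (R - P) 1, (R - P) 2;
                (S - P) 0, (S - P) 1, (S - P) 2]

/-- Six times the oriented volume of the tetrahedron `C₀ C₁ B_{i+1} B_i`.  This order of the
vertices is a consistent orientation of the tetrahedra. -/
def sixVolume {p q : ℕ} (φ : Pi1 p q →* E3) (x : Param) (i : ZMod p) : ℝ :=
  tripleProduct (tetPoint φ x i 0) (tetPoint φ x i 1) (tetPoint φ x i 3) (tetPoint φ x i 2)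

/-! ### Dihedral angles and defect angles as functions of edge lengths -/

/-- The matrix of distances between the vertices of a tetrahedron whose edges
`01, 02, 03, 12, 13, 23` have lengths `m`. -/
def tetDist (m : Fin 6 → ℝ) : Fin 4 → Fin 4 → ℝ :=
  ![![0, m 0, m 1, m 2], ![m 0, 0, m 3, m 4], ![m 1, m 3, 0, m 5], ![m 2, m 4, m 5, 0]]

/-- The lengths of the edges of `L(p,q)` are the distances between the images of the vertices of
every tetrahedron. -/
theorem dist_tetPoint {p q : ℕ} (φ : Pi1 p q →* E3) (x : Param) (i : ZMod p) (u v : Fin 4) :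
    dist (tetPoint φ x i u) (tetPoint φ x i v) =
      tetDist (fun n => edgeLength φ x (tetLabel q i n)) u v := by
  have hrel : ∀ m : Fin 4, edgePath q (tetLabel q i (faceEdges m).1) *
      edgePath q (tetLabel q i (faceEdges m).2.1) =
      edgePath q (tetLabel q i (faceEdges m).2.2) := by
    intro m
    have h := PresentedGroup.one_of_mem (rels := relators p q) (Or.inr ⟨i, m, rfl⟩)
    simp only [map_mul, map_inv, mul_inv_eq_one] at h
    exact h
  have h0 := hrel 0
  have h1 := hrel 1
  have h3 := hrel 3
  simp only [faceEdges, tetLabel, tetEdge, edgeClass, Fin.isValue, Matrix.cons_val] at h0 h1 h3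
  fin_cases u <;> fin_cases v <;>
    simp [tetPoint, tetDist, edgeLength, develop, tetLabel, tetEdge, edgeClass, Edge.src, Edge.tgt,
      dist_comm, ← h0, ← h1, (φ _).dist_eq] <;>
    rw [← h3, map_mul] <;>
    exact (φ _).dist_eq _ _
/-- Inner product of the vectors `xu` and `xv`, from distances. -/
def innerFrom (d : Fin 4 → Fin 4 → ℝ) (x u v : Fin 4) : ℝ :=
  (d x u ^ 2 + d x v ^ 2 - d u v ^ 2) / 2

/-- `|xy|²` times the inner product of the components of `xu` and `xv` orthogonal to `xy`. -/
def orthInner (d : Fin 4 → Fin 4 → ℝ) (x y u v : Fin 4) : ℝ :=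
  innerFrom d x u v * innerFrom d x y y - innerFrom d x u y * innerFrom d x v y

/-- Dihedral angle at the edge `xy` of a tetrahedron `xyzw`, from distances. -/
def dihedral (d : Fin 4 → Fin 4 → ℝ) (x y z w : Fin 4) : ℝ :=
  arccos (orthInner d x y z w / √(orthInner d x y z z * orthInner d x y w w))

/-- `dihedral` is the angle between the components of `xz` and `xw` orthogonal to `xy` (multiplied
by `|xy|²`). -/
theorem dihedral_eq_angle (P : Fin 4 → Space) (x y z w : Fin 4) (hxy : P x ≠ P y) :
    dihedral (fun u v => dist (P u) (P v)) x y z w =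
      InnerProductGeometry.angle
        (‖P y - P x‖ ^ 2 • (P z - P x) - inner ℝ (P z - P x) (P y - P x) • (P y - P x))
        (‖P y - P x‖ ^ 2 • (P w - P x) - inner ℝ (P w - P x) (P y - P x) • (P y - P x)) := by
  have hd : ∀ u v, innerFrom (fun u v => dist (P u) (P v)) x u v =
      inner ℝ (P u - P x) (P v - P x) := by
    intro u v
    have h : P u - P v = (P u - P x) - (P v - P x) := by abel
    simp only [innerFrom]
    rw [dist_comm (P x) (P u), dist_comm (P x) (P v), dist_eq_norm, dist_eq_norm, dist_eq_norm, h,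
      norm_sub_sq_real (P u - P x) (P v - P x)]
    ring
  set n := P y - P x with hn
  have hn0 : 0 < ‖n‖ ^ 2 := by
    have : n ≠ 0 := sub_ne_zero.mpr hxy.symm
    positivity
  have key : ∀ u v, inner ℝ (‖n‖ ^ 2 • (P u - P x) - inner ℝ (P u - P x) n • n)
      (‖n‖ ^ 2 • (P v - P x) - inner ℝ (P v - P x) n • n) =
      ‖n‖ ^ 2 * orthInner (fun u v => dist (P u) (P v)) x y u v := by
    intro u v
    simp only [orthInner, hd, ← hn]
    generalize P u - P x = U
    generalize P v - P x = W
    simp only [inner_sub_left, inner_sub_right, real_inner_smul_left, real_inner_smul_right,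
      real_inner_self_eq_norm_sq, real_inner_comm W n]
    ring
  have hnorm : ∀ u, ‖‖n‖ ^ 2 • (P u - P x) - inner ℝ (P u - P x) n • n‖ =
      √(‖n‖ ^ 2 * orthInner (fun u v => dist (P u) (P v)) x y u u) := by
    intro u
    rw [← key, real_inner_self_eq_norm_sq, Real.sqrt_sq (norm_nonneg _)]
  have hnn : ∀ u, 0 ≤ orthInner (fun u v => dist (P u) (P v)) x y u u := by
    intro u
    have h := key u u
    rw [real_inner_self_eq_norm_sq] at h
    exact nonneg_of_mul_nonneg_right (h ▸ sq_nonneg _) hn0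
  unfold dihedral InnerProductGeometry.angle
  congr 1
  rw [key, hnorm, hnorm, Real.sqrt_mul (hnn z), Real.sqrt_mul hn0.le, Real.sqrt_mul hn0.le,
    Real.sqrt_sq (norm_nonneg _),
    show ∀ A B : ℝ, ‖n‖ * A * (‖n‖ * B) = ‖n‖ ^ 2 * (A * B) from fun A B => by ring,
    mul_div_mul_left _ _ hn0.ne']

/-- The two vertices of each of the edges `01, 02, 03, 12, 13, 23`, followed by the other two. -/
def edgeVerts : Fin 6 → Fin 4 × Fin 4 × Fin 4 × Fin 4 :=
  ![(0, 1, 2, 3), (0, 2, 1, 3), (0, 3, 1, 2), (1, 2, 0, 3), (1, 3, 0, 2), (2, 3, 0, 1)]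

/-- Dihedral angle at the `n`-th edge of a tetrahedron with edge lengths `m`. -/
def dihedralAt (m : Fin 6 → ℝ) (n : Fin 6) : ℝ :=
  dihedral (tetDist m) (edgeVerts n).1 (edgeVerts n).2.1 (edgeVerts n).2.2.1 (edgeVerts n).2.2.2

/-- Defect angle at `e` for edge lengths `l` and signs `ε` of the tetrahedra: minus the algebraic
sum of the dihedral angles at `e`, over all tetrahedra and all their edges that belong to `e`. -/
def defect {p : ℕ} [NeZero p] (q : ℕ) (ε : ZMod p → ℝ) (l : Edge p → ℝ) (e : Edge p) : ℝ :=
  -∑ i : ZMod p, ∑ n : Fin 6,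
    if tetLabel q i n = e then ε i * dihedralAt (fun m => l (tetLabel q i m)) n else 0

/-- The matrix `F = ((1 / (lᵢ lⱼ)) ∂ωᵢ/∂lⱼ)`. -/
def matF {p q : ℕ} [NeZero p] (φ : Pi1 p q →* E3) (x : Param) : Matrix (Edge p) (Edge p) ℝ :=
  Matrix.of fun e e' =>
    1 / (edgeLength φ x e * edgeLength φ x e') *
      deriv (fun t => defect q (fun i => Real.sign (sixVolume φ x i))
        (Function.update (edgeLength φ x) e' t) e) (edgeLength φ x e')

/-- The set of edges `𝒞 = {b₁, …, b_{p-2}}`. -/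
def setC {p : ℕ} (n : Fin (p - 2)) : Edge p := Edge.b ((n : ℕ) + 1)

/-- The complementary set of edges `{a, b₀, b_{p-1}, c}`. -/
def setCBar {p : ℕ} : Fin 4 → Edge p := ![Edge.a, Edge.b 0, Edge.b (p - 1), Edge.c]

/-- The determinant of `F|_𝒞`. -/
def detFC {p q : ℕ} [NeZero p] (φ : Pi1 p q →* E3) (x : Param) : ℝ :=
  ((matF φ x).submatrix setC setC).det

/-! ### The differential form -/

/-- Exterior product of `n` covectors:
`(θ₀ ∧ ⋯ ∧ θ_{n-1})(v₀, …, v_{n-1}) = det (θ_j (v_i))`. -/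
def wedge {V : Type*} [AddCommGroup V] [Module ℝ V] {n : ℕ} (θ : Fin n → V →ₗ[ℝ] ℝ) :
    V [⋀^Fin n]→ₗ[ℝ] ℝ :=
  Matrix.detRowAlternating.compLinearMap (LinearMap.pi θ)

/-- The 1-form `l dl` of an edge, at the point `x` of the space of parameters. -/
def lengthForm {p q : ℕ} (φ : Pi1 p q →* E3) (x : Param) (e : Edge p) : Param →ₗ[ℝ] ℝ :=
  edgeLength φ x e • (fderiv ℝ (fun y => edgeLength φ y e) x : Param →L[ℝ] ℝ).toLinearMap

/-- The form `|⋀ l dl / √|det(F|_𝒞) ∏ 6V||` (wedge over the complement of `𝒞`, product over all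
tetrahedra) at the point `x`, evaluated on vectors `v`. -/
def theForm {p q : ℕ} [NeZero p] (φ : Pi1 p q →* E3) (x : Param) (v : Fin 4 → Param) : ℝ :=
  |wedge (fun n => lengthForm φ x (setCBar n)) v /
    √(|detFC φ x * (∏ i : ZMod p, sixVolume φ x i)|)|

/-- The 4-form `ρ dρ ∧ σ dσ ∧ ds ∧ dα` at the point `x = (ρ, σ, s, α)`. -/
def cylForm (x : Param) : Param [⋀^Fin 4]→ₗ[ℝ] ℝ :=
  wedge ![x 0 • LinearMap.proj 0, x 1 • LinearMap.proj 1, LinearMap.proj 2, LinearMap.proj 3]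

/-- The parameters with `ρ, σ > 0` for which all tetrahedra are nondegenerate and the denominator
of the form does not vanish, so that the form is defined. -/
def formDomain {p q : ℕ} [NeZero p] (φ : Pi1 p q →* E3) : Set Param :=
  {x | 0 < x 0 ∧ 0 < x 1 ∧ (∀ i : ZMod p, sixVolume φ x i ≠ 0) ∧ detFC φ x ≠ 0}

end LensForm

end

noncomputable section

namespace LensForm

section WeightedGram

open Matrix

/-! ### A determinant identity for complementary column spaces -/

section DetIdentity

variable {ι κ₁ κ₂ : Type*} [Fintype ι] [Fintype κ₁] [Fintype κ₂] [DecidableEq κ₁] [DecidableEq κ₂]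

/-! Write θ for the rotation angle and L for the operator (L y)_i = y_i - y_{i+1} - y_{i-q} +
y_{i+1-q} on functions on ℤ/p (`lateralMatrix`). Both ingredients of the denominator are governed by
L.

In each tetrahedron the opposite edges C₀C₁ and B_iB_{i+1} are horizontal. Therefore the signed
derivatives of dihedral angles at lateral edges are the sum of a rank-one term over 6V_i and of
terms that depend only on a single face (`sum_mul_lateralDeriv`). Each face lies in two tetrahedra
with opposite signs, so after summation only -Lᵀ diag(1/6V) L survives (`matF_b_b`). The volumes,
for their part, are 6V = -s·L X with X_j the horizontal cross product of C₀ and B_j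
(`sixVolume_eq_mulVec`).

Let M consist of the columns of L with indices 1, …, p-2. The orthogonal complement of its column
space is spanned by the constant 1 and a sawtooth function. Passing to this complement turns det(Mᵀ
diag(1/w) M)·∏w, up to a positive constant, into a 2×2 determinant (`det_gram_inv_mul_prod`). For w
= 6V its first diagonal entry ∑w vanishes, since w is in the image of L and 1 is orthogonal to it.
What remains is minus the square of a multiple of s(X_0 - X_{-1}), hence |det F|_𝒞 · ∏6V| = c·K²
with K = sρσ(sin(α+θ) - sin α) (`exists_detFC_mul_prod_sixVolume`).

In the numerator, l dl for a and c is a constant multiple of ρdρ and σdσ, and the ds, dα components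
for b₀ and b_{p-1} have determinant K (`wedge_lengthForm`). So K cancels, and I = 4(1-cos θ)(1-cos
qθ)/√c. Density holds because, for fixed ρ and σ, degeneracy requires s = 0 or one of countably many
α. -/

theorem det_transpose_mul_of_equiv (e : ι ≃ κ₁) (A B : Matrix ι κ₁ ℝ) :
    (Aᵀ * B).det = (A.submatrix e.symm id).det * (B.submatrix e.symm id).det := by
  rw [← Matrix.det_transpose (A.submatrix e.symm id), ← Matrix.det_mul, Matrix.transpose_submatrix,
    Matrix.submatrix_mul_equiv, Matrix.submatrix_id_id]

/-- If the columns of `M` and `N` are orthogonal and together as many as the rows, then the Gram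
determinants of `M` for the weights `w⁻¹` and of `N` for the weights `w` are proportional. -/
theorem det_gram_inv_mul_prod [DecidableEq ι] (e : ι ≃ κ₁ ⊕ κ₂) (M : Matrix ι κ₁ ℝ)
    (N : Matrix ι κ₂ ℝ) (w : ι → ℝ) (hw : ∀ i, w i ≠ 0) (hMN : Mᵀ * N = 0) :
    (Mᵀ * (diagonal w⁻¹ * M)).det * (Nᵀ * N).det * ∏ i, w i =
      (Mᵀ * M).det * (Nᵀ * (diagonal w * N)).det := by
  have hNM : Nᵀ * M = 0 := by
    have h := congrArg Matrix.transpose hMN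
    simpa [Matrix.transpose_mul] using h
  have hWw : diagonal w⁻¹ * diagonal w = 1 := by
    rw [Matrix.diagonal_mul_diagonal, ← Matrix.diagonal_one]
    congr 1
    ext i
    exact inv_mul_cancel₀ (hw i)
  -- By orthogonality `Pᵀ * R` and `Pᵀ * Q` are block triangular, with the wanted Gram determinants
  -- on the diagonal. As `R` is `Q` with rows divided by `w`, the two determinants differ by the
  -- factor `∏ w`. The matrices become square only through `e`, whose choice affects both factors of
  -- each product alike.
  set P := fromCols M N
  set R := fromCols (diagonal w⁻¹ * M) N
  set Q := fromCols M (diagonal w * N)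
  have hRQ : R = diagonal w⁻¹ * Q := by
    rw [Matrix.mul_fromCols, ← Matrix.mul_assoc, hWw, Matrix.one_mul]
  have h1 : (Pᵀ * R).det = (Mᵀ * (diagonal w⁻¹ * M)).det * (Nᵀ * N).det := by
    rw [Matrix.transpose_fromCols, Matrix.fromRows_mul_fromCols, hMN,
      Matrix.det_fromBlocks_zero₁₂]
  have h2 : (Pᵀ * Q).det = (Mᵀ * M).det * (Nᵀ * (diagonal w * N)).det := by
    rw [Matrix.transpose_fromCols, Matrix.fromRows_mul_fromCols, hNM,
      Matrix.det_fromBlocks_zero₂₁]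
  have h3 : (R.submatrix e.symm id).det = (∏ i, w i)⁻¹ * (Q.submatrix e.symm id).det := by
    have h : R.submatrix e.symm id =
        (diagonal w⁻¹).submatrix e.symm e.symm * Q.submatrix e.symm id := by
      rw [hRQ, Matrix.submatrix_mul_equiv]
    rw [h, Matrix.det_mul, Matrix.det_submatrix_equiv_self, Matrix.det_diagonal]
    simp [Finset.prod_inv_distrib]
  rw [← h1, ← h2, det_transpose_mul_of_equiv e, det_transpose_mul_of_equiv e, h3]
  have hprod : ∏ i, w i ≠ 0 := Finset.prod_ne_zero_iff.mpr fun i _ => hw i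
  field_simp

theorem det_transpose_mul_self_pos (M : Matrix ι κ₁ ℝ)
    (hM : ∀ y : κ₁ → ℝ, M *ᵥ y = 0 → y = 0) : 0 < (Mᵀ * M).det := by
  have h : (Mᵀ * M).PosDef := by
    rw [← Matrix.conjTranspose_eq_transpose_of_trivial]
    refine Matrix.PosDef.conjTranspose_mul_self M ?_
    intro y z hyz
    have h := hM (y - z) (by rw [Matrix.mulVec_sub]; exact sub_eq_zero.mpr hyz)
    exact sub_eq_zero.mp h
  exact h.det_pos

end DetIdentity

/-! ### The indices 1, …, p-2 in ℤ/p. -/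

section Index

variable {p : ℕ}

/-- The indices of the edges `b₁, …, b_{p-2}`. -/
def innerIndex (n : Fin (p - 2)) : ZMod p := ((n : ℕ) : ZMod p) + 1

theorem innerIndex_eq (n : Fin (p - 2)) : innerIndex n = (((n : ℕ) + 1 : ℕ) : ZMod p) := by
  simp [innerIndex]

theorem innerIndex_val (n : Fin (p - 2)) : (innerIndex n).val = (n : ℕ) + 1 := by
  rw [innerIndex_eq, ZMod.val_natCast_of_lt (by omega)]

theorem innerIndex_injective : Function.Injective (innerIndex (p := p)) := by
  intro m n h
  have h := congrArg ZMod.val h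
  rw [innerIndex_val, innerIndex_val] at h
  exact Fin.ext (Nat.succ_injective h)

theorem innerIndex_ne_zero (n : Fin (p - 2)) : innerIndex n ≠ 0 := by
  intro h
  have h := congrArg ZMod.val h
  rw [innerIndex_val, ZMod.val_zero] at h
  omega

theorem innerIndex_add_one_ne_zero (n : Fin (p - 2)) : innerIndex n + 1 ≠ 0 := by
  intro h
  have h1 : innerIndex n + 1 = (((n : ℕ) + 2 : ℕ) : ZMod p) := by
    rw [innerIndex_eq]; push_cast; ring
  have h := congrArg ZMod.val h
  rw [h1, ZMod.val_natCast_of_lt (by omega), ZMod.val_zero] at h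
  omega

end Index

/-! ### The incidence matrix of the lateral edges -/

section Incidence

variable {p : ℕ} [NeZero p]

/-- The function `e_i - e_{i+1} - e_{i-q} + e_{i+1-q}` on `ℤ/p`. -/
def lateral (q : ℕ) (i j : ZMod p) : ℝ :=
  (if i = j then 1 else 0) - (if i + 1 = j then 1 else 0) - (if i - q = j then 1 else 0) +
    (if i + 1 - q = j then 1 else 0)

/-- The matrix with rows `lateral q i`. -/
def lateralMatrix (p q : ℕ) [NeZero p] : Matrix (ZMod p) (ZMod p) ℝ := Matrix.of (lateral q)

theorem lateralMatrix_mulVec (q : ℕ) (y : ZMod p → ℝ) (i : ZMod p) :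
    (lateralMatrix p q *ᵥ y) i = y i - y (i + 1) - y (i - q) + y (i + 1 - q) := by
  simp [Matrix.mulVec, dotProduct, lateralMatrix, lateral, add_mul, sub_mul, Finset.sum_add_distrib,
    Finset.sum_sub_distrib]

theorem vecMul_lateralMatrix (q : ℕ) (y : ZMod p → ℝ) (j : ZMod p) :
    (y ᵥ* lateralMatrix p q) j = y j - y (j - 1) - y (j + q) + y (j - 1 + q) := by
  have h1 : ∀ i m : ZMod p, i + 1 = m ↔ i = m - 1 := fun i m => eq_sub_iff_add_eq.symm
  have h2 : ∀ i : ZMod p, i - q = j ↔ i = j + q := fun i => sub_eq_iff_eq_add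
  rw [show j - 1 + (q : ZMod p) = j + q - 1 by ring]
  simp only [Matrix.vecMul, dotProduct, lateralMatrix, lateral, mul_add, mul_sub, Finset.sum_add_distrib,
    Finset.sum_sub_distrib, h1, h2, Matrix.of_apply, mul_ite, mul_one, mul_zero,
    Finset.sum_ite_eq', Finset.mem_univ, if_true]

/-- Being coprime to p, q generates ℤ/p: every i is n·q with n a representative of i·q⁻¹. -/
theorem eq_zero_of_add_natCast_eq {q : ℕ} (hpq : p.Coprime q) (y : ZMod p → ℝ)
    (h : ∀ i, y (i + q) = y i) (i : ZMod p) : y i = y 0 := by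
  have hn : ∀ n : ℕ, y (n * q) = y 0 := by
    intro n
    induction n with
    | zero => simp
    | succ n ih => rw [← ih, ← h (n * q)]; push_cast; ring_nf
  have h2 := hn (i * (q : ZMod p)⁻¹).val
  rwa [ZMod.natCast_val, ZMod.cast_id, mul_assoc, mul_comm _ (q : ZMod p),
    ZMod.coe_mul_inv_eq_one q hpq.symm, mul_one] at h2

/-- The operator is the product of a difference with step 1 and a difference with step q. A function
in the kernel has constant q-differences; these sum to 0 around the cycle, so they vanish. -/
theorem eq_const_of_lateralMatrix_mulVec_eq_zero {q : ℕ} (hpq : p.Coprime q) (y : ZMod p → ℝ)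
    (h : lateralMatrix p q *ᵥ y = 0) (i : ZMod p) : y i = y 0 := by
  have hz : ∀ i, y i - y (i - q) = y 0 - y (0 - q) := by
    refine eq_zero_of_add_natCast_eq (q := 1) (Nat.coprime_one_right p)
      (fun i => y i - y (i - q)) fun i => ?_
    have hi := congrFun h i
    rw [lateralMatrix_mulVec, Pi.zero_apply] at hi
    push_cast
    linarith
  have hsum : ∑ i : ZMod p, (y i - y (i - q)) = 0 := by
    rw [Finset.sum_sub_distrib, sub_eq_zero]
    exact (Equiv.sum_comp (Equiv.subRight (q : ZMod p)) y).symm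
  simp only [hz, Finset.sum_const, Finset.card_univ, ZMod.card, nsmul_eq_mul, mul_eq_zero,
    Nat.cast_eq_zero, NeZero.ne p, false_or] at hsum
  refine eq_zero_of_add_natCast_eq hpq y (fun j => ?_) i
  have hj := hz (j + q)
  rw [add_sub_cancel_right] at hj
  linarith

/-- The sawtooth function `q m + q - 1 ↦ m`, `0 ≤ m < p`, on `ℤ/p`. -/
def sawtooth (q : ℕ) (i : ZMod p) : ℝ := (((i + 1 - q) * (q : ZMod p)⁻¹).val : ℝ)

/-- A shift by q raises m by 1, except for the drop from p-1 to 0, which happens at i = q(p-1) + q -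
1 = -1. -/
theorem sawtooth_add {q : ℕ} (hpq : p.Coprime q) (i : ZMod p) :
    sawtooth q (i + (q : ZMod p)) = sawtooth q i + 1 - if i + 1 = 0 then (p : ℝ) else 0 := by
  have hq := ZMod.coe_mul_inv_eq_one q hpq.symm
  have h1 : (i + q + 1 - q) * (q : ZMod p)⁻¹ = (i + 1 - q) * (q : ZMod p)⁻¹ + 1 := by
    linear_combination hq
  have h2 : i + 1 = 0 ↔ (i + 1 - q) * (q : ZMod p)⁻¹ + 1 = 0 := by
    constructor
    · intro h; linear_combination (q : ZMod p)⁻¹ * h - hq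
    · intro h; linear_combination (q : ZMod p) * h - (i + 1 - q) * hq
  simp only [sawtooth, h1, h2]
  generalize (i + 1 - q) * (q : ZMod p)⁻¹ = m
  have hm : m + 1 = ((m.val + 1 : ℕ) : ZMod p) := by simp
  have hlt := ZMod.val_lt m
  by_cases h : m + 1 = 0
  · have hd : p ∣ m.val + 1 := by
      rw [hm] at h
      exact (ZMod.natCast_eq_zero_iff _ _).mp h
    have hval : m.val + 1 = p := le_antisymm hlt (Nat.le_of_dvd (Nat.succ_pos _) hd)
    have hval' : (m.val : ℝ) + 1 = p := by exact_mod_cast hval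
    rw [if_pos h, h, ZMod.val_zero, hval']
    simp
  · rw [if_neg h]
    have hne : m.val + 1 < p := by
      refine lt_of_le_of_ne hlt fun he => h ?_
      rw [hm, he]; simp
    rw [hm, ZMod.val_natCast_of_lt hne]
    push_cast; ring

/-- The q-difference of the sawtooth is a constant minus p times a delta function, and the second
difference kills the constant. The result is supported on the indices -1 and 0, which are exactly
the lateral edges left out of 𝒞; hence the orthogonality to the inner columns. -/
theorem sawtooth_vecMul_lateralMatrix {q : ℕ} (hpq : p.Coprime q) (j : ZMod p) :
    (sawtooth q ᵥ* lateralMatrix p q) j =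
      p * ((if j + 1 = 0 then 1 else 0) - if j = 0 then 1 else 0) := by
  rw [vecMul_lateralMatrix, sawtooth_add hpq, sawtooth_add hpq, sub_add_cancel]
  split_ifs <;> ring

/-- The columns of `lateralMatrix` that belong to the edges `b₁, …, b_{p-2}`. -/
def innerMatrix (p q : ℕ) [NeZero p] : Matrix (ZMod p) (Fin (p - 2)) ℝ :=
  (lateralMatrix p q).submatrix id innerIndex

/-- A basis of the orthogonal complement of the columns of `innerMatrix`. -/
def complMatrix (p q : ℕ) [NeZero p] : Matrix (ZMod p) (Fin 2) ℝ :=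
  Matrix.of fun i => ![1, sawtooth q i]

theorem one_vecMul_lateralMatrix (q : ℕ) (j : ZMod p) :
    ((fun _ => 1) ᵥ* lateralMatrix p q) j = 0 := by
  rw [vecMul_lateralMatrix]; ring

theorem innerMatrix_transpose_mul_complMatrix {q : ℕ} (hpq : p.Coprime q) :
    (innerMatrix p q)ᵀ * complMatrix p q = 0 := by
  ext n m
  fin_cases m
  · rw [Matrix.zero_apply, ← one_vecMul_lateralMatrix q (innerIndex n)]
    simp [Matrix.mul_apply, Matrix.vecMul, dotProduct, innerMatrix, complMatrix]
  · have h := sawtooth_vecMul_lateralMatrix hpq (innerIndex n)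
    rw [if_neg (innerIndex_ne_zero n), if_neg (innerIndex_add_one_ne_zero n)] at h
    rw [Matrix.zero_apply, ← show (p : ℝ) * (0 - 0) = 0 by ring, ← h]
    simp [Matrix.mul_apply, Matrix.vecMul, dotProduct, innerMatrix, complMatrix, mul_comm]

/-- Extended by zero, a kernel vector becomes a constant function on ℤ/p that vanishes at 0. -/
theorem innerMatrix_mulVec_injective {q : ℕ} (hpq : p.Coprime q) (y : Fin (p - 2) → ℝ)
    (h : innerMatrix p q *ᵥ y = 0) : y = 0 := by
  let Y : ZMod p → ℝ := fun j => ∑ n, if innerIndex n = j then y n else 0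
  have hY : lateralMatrix p q *ᵥ Y = 0 := by
    rw [← h]
    ext i
    simp only [Matrix.mulVec, dotProduct, Y, innerMatrix, Finset.mul_sum]
    rw [Finset.sum_comm]
    simp
  have hc := eq_const_of_lateralMatrix_mulVec_eq_zero hpq Y hY
  have h0 : Y 0 = 0 := by simp [Y, innerIndex_ne_zero]
  ext n
  have hn := hc (innerIndex n)
  rw [h0] at hn
  simpa [Y, innerIndex_injective.eq_iff] using hn

theorem complMatrix_mulVec_injective {q : ℕ} (hp : 2 ≤ p) (hpq : p.Coprime q) (y : Fin 2 → ℝ)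
    (h : complMatrix p q *ᵥ y = 0) : y = 0 := by
  have hi : ∀ i : ZMod p, y 0 + sawtooth q i * y 1 = 0 := fun i => by
    simpa [Matrix.mulVec, dotProduct, Fin.sum_univ_two, complMatrix] using congrFun h i
  have h1 := hi 0
  have h2 := hi (0 + (q : ZMod p))
  -- The sawtooth does not drop between 0 and q, so these two rows already force `y 1 = 0`.
  have h10 : (0 : ZMod p) + 1 ≠ 0 := by
    rw [zero_add]
    have : Fact (1 < p) := ⟨hp⟩
    exact one_ne_zero
  rw [sawtooth_add hpq, if_neg h10] at h2
  have hy1 : y 1 = 0 := by linarith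
  rw [hy1, mul_zero, add_zero] at h1
  ext m
  fin_cases m
  · exact h1
  · exact hy1

/-- The weighted Gram determinant of the columns of `lateralMatrix` belonging to
`b₁, …, b_{p-2}`, when the inverse weights are in the image of `lateralMatrix`. -/
theorem exists_det_innerMatrix {q : ℕ} (hp : 2 ≤ p) (hpq : p.Coprime q) :
    ∃ c : ℝ, 0 < c ∧ ∀ (X w : ZMod p → ℝ) (t : ℝ), (∀ i, w i = t * (lateralMatrix p q *ᵥ X) i) →
      (∀ i, w i ≠ 0) →
      ((innerMatrix p q)ᵀ * (diagonal w⁻¹ * innerMatrix p q)).det * ∏ i, w i =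
        -(c * (t * (X 0 - X (-1))) ^ 2) := by
  set M := innerMatrix p q
  set N := complMatrix p q
  have hM : 0 < (Mᵀ * M).det :=
    det_transpose_mul_self_pos M (innerMatrix_mulVec_injective hpq)
  have hN : 0 < (Nᵀ * N).det :=
    det_transpose_mul_self_pos N (complMatrix_mulVec_injective hp hpq)
  have hp0 : (0 : ℝ) < p := by exact_mod_cast (by omega : 0 < p)
  refine ⟨(Mᵀ * M).det / (Nᵀ * N).det * (p : ℝ) ^ 2, by positivity, fun X w t hwX hw => ?_⟩
  have e : ZMod p ≃ Fin (p - 2) ⊕ Fin 2 := Fintype.equivOfCardEq (by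
    simp [ZMod.card]; omega)
  have key := det_gram_inv_mul_prod e M N w hw (innerMatrix_transpose_mul_complMatrix hpq)
  have hsum : ∀ y : ZMod p → ℝ, ∑ i, y i * w i = t * ((y ᵥ* lateralMatrix p q) ⬝ᵥ X) := by
    intro y
    rw [← Matrix.dotProduct_mulVec]
    simp only [dotProduct, hwX, Finset.mul_sum]
    exact Finset.sum_congr rfl fun i _ => by ring
  -- This is the (0,0) entry of the 2×2 matrix below; its vanishing makes the determinant minus a
  -- perfect square.
  have hs1 : ∑ i, w i = 0 := by
    have h := hsum fun _ => 1
    have h0 : ((fun _ => 1) ᵥ* lateralMatrix p q) = 0 := funext (one_vecMul_lateralMatrix q)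
    simpa [h0] using h
  have hs2 : ∑ i, sawtooth q i * w i = t * (p * (X (-1) - X 0)) := by
    rw [hsum]
    congr 1
    simp only [dotProduct, sawtooth_vecMul_lateralMatrix hpq, mul_assoc, ← Finset.mul_sum, sub_mul,
      Finset.sum_sub_distrib, add_eq_zero_iff_eq_neg]
    simp
  have hdet : (Nᵀ * (diagonal w * N)).det = -(t * (p * (X (-1) - X 0))) ^ 2 := by
    rw [Matrix.det_fin_two]
    have h00 : (Nᵀ * (diagonal w * N)) 0 0 = ∑ i, w i := by
      rw [Matrix.mul_apply]; simp [N, complMatrix, Matrix.diagonal_mul]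
    have h01 : (Nᵀ * (diagonal w * N)) 0 1 = ∑ i, sawtooth q i * w i := by
      rw [Matrix.mul_apply]; simp [N, complMatrix, Matrix.diagonal_mul, mul_comm]
    have h10 : (Nᵀ * (diagonal w * N)) 1 0 = ∑ i, sawtooth q i * w i := by
      rw [Matrix.mul_apply]; simp [N, complMatrix, Matrix.diagonal_mul]
    rw [h00, h01, h10, hs1, hs2]
    ring
  rw [hdet] at key
  field_simp
  linear_combination key

end Incidence

end WeightedGram

open Real

/-! ### Derivatives of dihedral angles -/

/-- The factor √(1 - A²/(BC)) from the derivative of arccos combines with √(BC) into √(BC - A²). For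
a dihedral angle this is the edge length times |6V|, so the volume becomes the denominator. -/
theorem hasDerivAt_arccos_div_sqrt {A B C : ℝ → ℝ} {A' B' C' t : ℝ} (hA : HasDerivAt A A' t)
    (hB : HasDerivAt B B' t) (hC : HasDerivAt C C' t) (hB0 : 0 < B t) (hC0 : 0 < C t)
    (h : A t ^ 2 < B t * C t) :
    HasDerivAt (fun s => arccos (A s / √(B s * C s)))
      (-(A' - A t * (B' / (2 * B t) + C' / (2 * C t))) / √(B t * C t - A t ^ 2)) t := by
  have hBC : 0 < B t * C t := mul_pos hB0 hC0
  have hS : 0 < √(B t * C t) := Real.sqrt_pos.mpr hBC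
  have hS2 : √(B t * C t) ^ 2 = B t * C t := Real.sq_sqrt hBC.le
  have hE : 0 < B t * C t - A t ^ 2 := sub_pos.mpr h
  have hR : 0 < √(B t * C t - A t ^ 2) := Real.sqrt_pos.mpr hE
  have hlt : (A t / √(B t * C t)) ^ 2 < 1 := by
    rw [div_pow, hS2, div_lt_one hBC]; exact h
  have habs := abs_lt.mp ((sq_lt_one_iff_abs_lt_one _).mp hlt)
  have h1 := (Real.hasDerivAt_arccos habs.1.ne' habs.2.ne).comp t
    (hA.div ((hB.mul hC).sqrt hBC.ne') hS.ne')
  refine h1.congr_deriv ?_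
  have hroot : √(1 - (A t / √(B t * C t)) ^ 2) = √(B t * C t - A t ^ 2) / √(B t * C t) := by
    rw [div_pow, hS2, ← Real.sqrt_div hE.le]
    congr 1
    field_simp
  simp only [Pi.mul_apply]
  rw [hroot]
  have hBne := hB0.ne'
  have hCne := hC0.ne'
  generalize √(B t * C t) = S at *
  field_simp
  rw [hS2]

theorem tetDist_comm (m : Fin 6 → ℝ) (u v : Fin 4) : tetDist m u v = tetDist m v u := by
  fin_cases u <;> fin_cases v <;> rfl

theorem tetDist_self (m : Fin 6 → ℝ) (u : Fin 4) : tetDist m u u = 0 := by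
  fin_cases u <;> rfl

theorem hasDerivAt_tetDist {m : ℝ → Fin 6 → ℝ} {m' : Fin 6 → ℝ} {t : ℝ}
    (hm : ∀ n, HasDerivAt (fun s => m s n) (m' n) t) (u v : Fin 4) :
    HasDerivAt (fun s => tetDist (m s) u v) (tetDist m' u v) t := by
  fin_cases u <;> fin_cases v <;> first | exact hasDerivAt_const t 0 | exact hm _

/-- `(1 - λ) / G`, where `λ` is the barycentric coordinate at the origin of the orthogonal
projection of `z` to the plane of the triangle `0 y w`; in terms of inner products. -/
def faceTerm (G yy ww yw zy zw : ℝ) : ℝ :=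
  (zy * (ww - yw) + zw * (yy - yw)) / (yy * ww - yw ^ 2) / G

/-- Derivative of the dihedral angle at `xy` if the lengths of `xz` and `yw` do not vary. -/
theorem hasDerivAt_dihedral {m : ℝ → Fin 6 → ℝ} {m' : Fin 6 → ℝ} {t : ℝ}
    (hm : ∀ n, HasDerivAt (fun s => m s n) (m' n) t) (x y z w : Fin 4) {d d' : Fin 4 → Fin 4 → ℝ}
    (hdm : d = tetDist (m t)) (hdm' : d' = tetDist m')
    (hxz : d' x z = 0) (hyw : d' y w = 0) (hxy : 0 < d x y)
    (hB : 0 < orthInner d x y z z) (hC : 0 < orthInner d x y w w) {G : ℝ} (hG0 : 0 < G)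
    (hG : orthInner d x y z z * orthInner d x y w w - orthInner d x y z w ^ 2 =
      (d x y * G) ^ 2) :
    HasDerivAt (fun s => dihedral (tetDist (m s)) x y z w)
      (d x y * ((d x y * d' x y + d z w * d' z w - d x w * d' x w - d z y * d' z y) / G +
        faceTerm G (innerFrom d x y y) (innerFrom d x w w) (innerFrom d x y w) (innerFrom d x z y)
          (innerFrom d x z w) *
            (d x w * d' x w - innerFrom d x y w / d x y ^ 2 * (d x y * d' x y)) +
        faceTerm G (innerFrom d y x x) (innerFrom d y z z) (innerFrom d y x z) (innerFrom d y w x)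
          (innerFrom d y w z) *
            (d z y * d' z y - innerFrom d y x z / d x y ^ 2 * (d x y * d' x y)))) t := by
  subst hdm hdm'
  have hd := hasDerivAt_tetDist hm
  have hin : ∀ u v, HasDerivAt (fun s => innerFrom (tetDist (m s)) x u v)
      (tetDist (m t) x u * tetDist m' x u + tetDist (m t) x v * tetDist m' x v -
        tetDist (m t) u v * tetDist m' u v) t := by
    intro u v
    have h := ((((hd x u).pow 2).add ((hd x v).pow 2)).sub ((hd u v).pow 2)).div_const 2
    refine h.congr_deriv ?_
    norm_num
    ring
  have hor : ∀ u v, HasDerivAt (fun s => orthInner (tetDist (m s)) x y u v) _ t := fun u v =>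
    ((hin u v).mul (hin y y)).sub ((hin u y).mul (hin v y))
  have hsq : orthInner (tetDist (m t)) x y z w ^ 2 <
      orthInner (tetDist (m t)) x y z z * orthInner (tetDist (m t)) x y w w := by
    rw [← sub_pos, hG]; positivity
  have h := hasDerivAt_arccos_div_sqrt (hor z w) (hor z z) (hor w w) hB hC hsq
  refine h.congr_deriv ?_
  have hxyG : 0 < tetDist (m t) x y * G := mul_pos hxy hG0
  rw [hG, Real.sqrt_sq hxyG.le]
  -- This is four times the squared area of the triangle xyz, so it may be computed from y as well
  -- as from x. It is then the denominator of the `faceTerm` based at y.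
  have hB' : orthInner (tetDist (m t)) x y z z =
      innerFrom (tetDist (m t)) y x x * innerFrom (tetDist (m t)) y z z -
        innerFrom (tetDist (m t)) y x z ^ 2 := by
    simp only [orthInner, innerFrom, tetDist_self, tetDist_comm _ y x, tetDist_comm _ z y]
    ring
  have hC' : orthInner (tetDist (m t)) x y w w =
      innerFrom (tetDist (m t)) x y y * innerFrom (tetDist (m t)) x w w -
        innerFrom (tetDist (m t)) x y w ^ 2 := by
    simp only [orthInner, innerFrom, tetDist_self, tetDist_comm _ w y]
    ring
  unfold faceTerm
  rw [← hB', ← hC']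
  have hBne := hB.ne'
  have hCne := hC.ne'
  generalize hBB : orthInner (tetDist (m t)) x y z z = B at *
  generalize hCC : orthInner (tetDist (m t)) x y w w = C at *
  have hGne := hG0.ne'
  have hxyne := hxy.ne'
  field_simp
  subst hBB hCC
  simp only [orthInner, innerFrom, tetDist_self, hxz, hyw, tetDist_comm _ y x, tetDist_comm _ w y,
    tetDist_comm _ y z, tetDist_comm _ w x, tetDist_comm _ w z]
  ring

/-! ### Tetrahedra with two horizontal opposite edges -/

/-- Inner product of vectors of `ℝ³`, in coordinates. -/
def dot3 (U V : Space) : ℝ := U 0 * V 0 + U 1 * V 1 + U 2 * V 2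

/-- Cross product of the horizontal components. -/
def cross2 (U V : Space) : ℝ := U 0 * V 1 - U 1 * V 0

theorem dist_sq_eq_dot3 (P Q : Space) : dist P Q ^ 2 = dot3 (Q - P) (Q - P) := by
  rw [EuclideanSpace.dist_eq, Real.sq_sqrt (by positivity)]
  simp only [Fin.sum_univ_three, Real.dist_eq, sq_abs, dot3, PiLp.sub_apply]
  ring

theorem innerFrom_dist (P : Fin 4 → Space) (x u v : Fin 4) :
    innerFrom (fun u v => dist (P u) (P v)) x u v = dot3 (P u - P x) (P v - P x) := by
  simp only [innerFrom, dist_sq_eq_dot3, dot3, PiLp.sub_apply]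
  ring

theorem tripleProduct_eq (P Q R S : Space) :
    tripleProduct P Q R S =
      (Q - P) 0 * ((R - P) 1 * (S - P) 2 - (R - P) 2 * (S - P) 1) +
      (Q - P) 1 * ((R - P) 2 * (S - P) 0 - (R - P) 0 * (S - P) 2) +
      (Q - P) 2 * ((R - P) 0 * (S - P) 1 - (R - P) 1 * (S - P) 0) := by
  rw [tripleProduct, Matrix.det_fin_three]
  simp
  ring

theorem tripleProduct_eq_mul_cross2 {X Y Z W : Space} (hZ : Z 2 = X 2) (hY : Y 2 = W 2) :
    tripleProduct X Z W Y = (Y - X) 2 * cross2 (Z - X) (W - Y) := by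
  rw [tripleProduct_eq]
  simp only [cross2, PiLp.sub_apply, ← hY, hZ]
  ring

theorem tripleProduct_sq (P Q R S : Space) :
    tripleProduct P Q R S ^ 2 =
      dot3 (Q - P) (Q - P) * dot3 (R - P) (R - P) * dot3 (S - P) (S - P) +
        2 * (dot3 (Q - P) (R - P) * dot3 (R - P) (S - P) * dot3 (Q - P) (S - P)) -
        dot3 (Q - P) (Q - P) * dot3 (R - P) (S - P) ^ 2 -
        dot3 (R - P) (R - P) * dot3 (Q - P) (S - P) ^ 2 -
        dot3 (S - P) (S - P) * dot3 (Q - P) (R - P) ^ 2 := by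
  rw [tripleProduct_eq]
  simp only [dot3]
  ring

theorem dot3_comm (U V : Space) : dot3 U V = dot3 V U := by simp only [dot3]; ring

theorem gram_nonneg (U V : Space) : 0 ≤ dot3 U U * dot3 V V - dot3 U V ^ 2 := by
  have h : dot3 U U * dot3 V V - dot3 U V ^ 2 =
      (U 0 * V 1 - U 1 * V 0) ^ 2 + (U 1 * V 2 - U 2 * V 1) ^ 2 + (U 2 * V 0 - U 0 * V 2) ^ 2 := by
    simp only [dot3]; ring
  rw [h]; positivity

/-- The quotient `(1 - λ) / 6V` for the barycentric coordinate `λ` at `X` of the projection of the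
fourth vertex to the face `X Y Y'`; it depends only on the face if `YY'` and the edge from `X` to
the fourth vertex are horizontal. -/
def faceCoeff (X Y Y' : Space) : ℝ :=
  cross2 (Y - X) (Y' - Y) / ((Y - X) 2 * (cross2 (Y - X) (Y' - Y) ^ 2 +
    (Y - X) 2 ^ 2 * ((Y' - Y) 0 ^ 2 + (Y' - Y) 1 ^ 2)))

theorem faceCoeff_swap {X Y Y' : Space} (h : Y 2 = Y' 2) :
    faceCoeff X Y' Y = -faceCoeff X Y Y' := by
  unfold faceCoeff
  have h1 : cross2 (Y' - X) (Y - Y') = -cross2 (Y - X) (Y' - Y) := by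
    simp only [cross2, PiLp.sub_apply]; ring
  rw [h1, ← neg_div]
  congr 1
  simp only [PiLp.sub_apply, h]
  ring

/-- Both the volume and the numerator of the barycentric coordinate contain the factor `cross2 (Z -
X) (W - Y)`, the only place where `Z` enters; it cancels. -/
theorem faceTerm_eq_faceCoeff {X Y Z W : Space} (hZ : Z 2 = X 2) (hY : Y 2 = W 2)
    (hV : tripleProduct X Z W Y ≠ 0)
    (hC : dot3 (Y - X) (Y - X) * dot3 (W - X) (W - X) - dot3 (Y - X) (W - X) ^ 2 ≠ 0) :
    faceTerm (tripleProduct X Z W Y) (dot3 (Y - X) (Y - X)) (dot3 (W - X) (W - X))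
      (dot3 (Y - X) (W - X)) (dot3 (Z - X) (Y - X)) (dot3 (Z - X) (W - X)) = faceCoeff X Y W := by
  have hC2 : dot3 (Y - X) (Y - X) * dot3 (W - X) (W - X) - dot3 (Y - X) (W - X) ^ 2 =
      cross2 (Y - X) (W - Y) ^ 2 + (Y - X) 2 ^ 2 * ((W - Y) 0 ^ 2 + (W - Y) 1 ^ 2) := by
    simp only [dot3, cross2, PiLp.sub_apply, ← hY]
    ring
  have hV2 := tripleProduct_eq_mul_cross2 hZ hY
  have hnum : dot3 (Z - X) (Y - X) * (dot3 (W - X) (W - X) - dot3 (Y - X) (W - X)) +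
      dot3 (Z - X) (W - X) * (dot3 (Y - X) (Y - X) - dot3 (Y - X) (W - X)) =
      cross2 (Z - X) (W - Y) * cross2 (Y - X) (W - Y) := by
    simp only [dot3, cross2, PiLp.sub_apply, ← hY, hZ]
    ring
  rw [hC2] at hC
  have h1 : (Y - X) 2 ≠ 0 := fun h => hV (by rw [hV2, h, zero_mul])
  have h2 : cross2 (Z - X) (W - Y) ≠ 0 := fun h => hV (by rw [hV2, h, mul_zero])
  unfold faceTerm faceCoeff
  rw [hC2, hnum, hV2]
  field_simp

/-- The ratio of the projection of `XY'` to `XY` and `XY`. -/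
def projRatio (X Y Y' : Space) : ℝ := dot3 (Y - X) (Y' - X) / dot3 (Y - X) (Y - X)

theorem faceTerm_smul (c G yy ww yw zy zw : ℝ) :
    faceTerm (c * G) yy ww yw zy zw = c⁻¹ * faceTerm G yy ww yw zy zw := by
  simp only [faceTerm, div_eq_mul_inv, mul_inv]
  ring

/-- Derivative of the dihedral angle at the edge `xy`, taken with the sign of the volume, if the
edges `xz` and `yw` are horizontal and their lengths do not vary. -/
theorem hasDerivAt_sign_mul_dihedral {m : ℝ → Fin 6 → ℝ} {m' : Fin 6 → ℝ} {t : ℝ}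
    (hm : ∀ n, HasDerivAt (fun s => m s n) (m' n) t) {P : Fin 4 → Space} (x y z w : Fin 4)
    {d d' : Fin 4 → Fin 4 → ℝ} (hdm : d = tetDist (m t)) (hdm' : d' = tetDist m')
    (hP : ∀ u v, dist (P u) (P v) = d u v) (hz : P z 2 = P x 2) (hy : P y 2 = P w 2) {V : ℝ}
    (hV : tripleProduct (P x) (P z) (P w) (P y) = V) (hV0 : V ≠ 0)
    (hxz : d' x z = 0) (hyw : d' y w = 0) :
    HasDerivAt (fun s => Real.sign V * dihedral (tetDist (m s)) x y z w)
      (d x y * ((d x y * d' x y + d z w * d' z w - d x w * d' x w - d z y * d' z y) / V +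
        faceCoeff (P x) (P y) (P w) *
          (d x w * d' x w - projRatio (P x) (P y) (P w) * (d x y * d' x y)) +
        faceCoeff (P y) (P x) (P z) *
          (d z y * d' z y - projRatio (P y) (P x) (P z) * (d x y * d' x y)))) t := by
  have hPd : d = fun u v => dist (P u) (P v) := by ext u v; rw [hP]
  have hin : ∀ a u v, innerFrom d a u v = dot3 (P u - P a) (P v - P a) := fun a u v => by
    rw [hPd, innerFrom_dist]
  have hd2 : d x y ^ 2 = dot3 (P y - P x) (P y - P x) := by rw [← hP, dist_sq_eq_dot3]
  have hd2' : d x y ^ 2 = dot3 (P x - P y) (P x - P y) := by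
    rw [← hP, dist_comm, dist_sq_eq_dot3]
  have hyx : P y ≠ P x := by
    intro h
    apply hV0
    rw [← hV, tripleProduct_eq, h]
    simp
  have hxy : 0 < d x y := by rw [← hP]; exact dist_pos.mpr hyx.symm
  -- The Gram determinant of the components orthogonal to xy, times |xy|², is (6V)². The values of
  -- `orthInner` carry an extra |xy|² each.
  have hG : orthInner d x y z z * orthInner d x y w w - orthInner d x y z w ^ 2 =
      (d x y * |V|) ^ 2 := by
    rw [mul_pow, sq_abs, hd2, ← hV, tripleProduct_sq]
    simp only [orthInner, hin, dot3_comm (P w - P x) (P y - P x)]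
    ring
  have hB2 : orthInner d x y z z = dot3 (P x - P y) (P x - P y) * dot3 (P z - P y) (P z - P y) -
      dot3 (P x - P y) (P z - P y) ^ 2 := by
    simp only [orthInner, hin, dot3, PiLp.sub_apply]
    ring
  have hC2 : orthInner d x y w w = dot3 (P y - P x) (P y - P x) * dot3 (P w - P x) (P w - P x) -
      dot3 (P y - P x) (P w - P x) ^ 2 := by
    simp only [orthInner, hin, dot3, PiLp.sub_apply]
    ring
  have hVpos : 0 < |V| := abs_pos.mpr hV0
  have hBC : 0 < orthInner d x y z z * orthInner d x y w w := by
    have : 0 < (d x y * |V|) ^ 2 := by positivity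
    rw [← hG] at this
    nlinarith [sq_nonneg (orthInner d x y z w)]
  have hB0 : 0 ≤ orthInner d x y z z := hB2 ▸ gram_nonneg _ _
  have hC0 : 0 ≤ orthInner d x y w w := hC2 ▸ gram_nonneg _ _
  have hB : 0 < orthInner d x y z z :=
    hB0.lt_of_ne fun h => by rw [← h, zero_mul] at hBC; exact hBC.false
  have hC : 0 < orthInner d x y w w :=
    hC0.lt_of_ne fun h => by rw [← h, mul_zero] at hBC; exact hBC.false
  have h := (hasDerivAt_dihedral hm x y z w hdm hdm' hxz hyw hxy hB hC hVpos hG).const_mul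
    (Real.sign V)
  refine h.congr_deriv ?_
  -- Every term of the derivative has |V| in its denominator, so the sign of V turns it into V
  -- itself.
  have hsV : Real.sign V * V = |V| := by
    rcases lt_or_gt_of_ne hV0 with h | h
    · rw [Real.sign_of_neg h, abs_of_neg h]; ring
    · rw [Real.sign_of_pos h, abs_of_pos h]; ring
  have hs0 : Real.sign V ≠ 0 := fun h => by rw [h, zero_mul] at hsV; exact hVpos.ne hsV
  have hV' : tripleProduct (P y) (P w) (P z) (P x) = V := by
    rw [← hV, tripleProduct_eq, tripleProduct_eq]
    simp only [PiLp.sub_apply]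
    ring
  have h1 := faceTerm_eq_faceCoeff hz hy (hV.trans_ne hV0) (hC2 ▸ hC.ne')
  have h2 := faceTerm_eq_faceCoeff (X := P y) (Y := P x) (Z := P w) (W := P z) hy.symm hz.symm
    (hV'.trans_ne hV0) (hB2 ▸ hB.ne')
  rw [hV] at h1
  rw [hV'] at h2
  simp only [hin]
  rw [← hsV, faceTerm_smul, faceTerm_smul, h1, h2]
  simp only [projRatio, ← hd2, ← hd2']
  field_simp

/-- The contribution of the face `X Y Y'` to the bilinear form of the derivatives of dihedral
angles; the arguments belong to the edges `XY` and `XY'`. -/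
def faceForm (X Y Y' : Space) (a b a' b' : ℝ) : ℝ :=
  faceCoeff X Y Y' * (a * (b' - projRatio X Y Y' * a') + b * (a' - projRatio X Y' Y * b'))

/-- Derivatives of the dihedral angles at the edges `02, 03, 12, 13`, divided by the lengths of
these edges, as functions of `l dl`. -/
def lateralDeriv (V : ℝ) (P : Fin 4 → Space) (ξ : Fin 6 → ℝ) : Fin 6 → ℝ :=
  ![0,
    (ξ 1 + ξ 4 - ξ 2 - ξ 3) / V +
      faceCoeff (P 0) (P 2) (P 3) * (ξ 2 - projRatio (P 0) (P 2) (P 3) * ξ 1) +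
      faceCoeff (P 2) (P 0) (P 1) * (ξ 3 - projRatio (P 2) (P 0) (P 1) * ξ 1),
    -((ξ 1 + ξ 4 - ξ 2 - ξ 3) / V) +
      faceCoeff (P 0) (P 2) (P 3) * (ξ 1 - projRatio (P 0) (P 3) (P 2) * ξ 2) -
      faceCoeff (P 3) (P 0) (P 1) * (ξ 4 - projRatio (P 3) (P 0) (P 1) * ξ 2),
    -((ξ 1 + ξ 4 - ξ 2 - ξ 3) / V) -
      faceCoeff (P 1) (P 2) (P 3) * (ξ 4 - projRatio (P 1) (P 2) (P 3) * ξ 3) +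
      faceCoeff (P 2) (P 0) (P 1) * (ξ 1 - projRatio (P 2) (P 1) (P 0) * ξ 3),
    (ξ 1 + ξ 4 - ξ 2 - ξ 3) / V -
      faceCoeff (P 1) (P 2) (P 3) * (ξ 3 - projRatio (P 1) (P 3) (P 2) * ξ 4) -
      faceCoeff (P 3) (P 0) (P 1) * (ξ 2 - projRatio (P 3) (P 1) (P 0) * ξ 4),
    0]

theorem hasDerivAt_dihedralAt {m : ℝ → Fin 6 → ℝ} {m' : Fin 6 → ℝ} {t : ℝ}
    (hm : ∀ n, HasDerivAt (fun s => m s n) (m' n) t) {P : Fin 4 → Space}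
    (hP : ∀ u v, dist (P u) (P v) = tetDist (m t) u v) (h01 : P 0 2 = P 1 2) (h23 : P 2 2 = P 3 2)
    {V : ℝ} (hV : tripleProduct (P 0) (P 1) (P 3) (P 2) = V) (hV0 : V ≠ 0)
    (hm0 : m' 0 = 0) (hm5 : m' 5 = 0) {n : Fin 6} (hn0 : n ≠ 0) (hn5 : n ≠ 5) :
    HasDerivAt (fun s => Real.sign V * dihedralAt (m s) n)
      (m t n * lateralDeriv V P (fun k => m t k * m' k) n) t := by
  -- For the edges 03 and 12 the vertex order required by `hasDerivAt_sign_mul_dihedral` has the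
  -- opposite orientation; for 02 and 13 it has the given one.
  have hs : Real.sign V = -Real.sign (-V) := by rw [Real.sign_neg, neg_neg]
  have hV2 : tripleProduct (P 0) (P 1) (P 2) (P 3) = -V := by
    rw [← hV, tripleProduct_eq, tripleProduct_eq]; ring
  have hV3 : tripleProduct (P 1) (P 0) (P 3) (P 2) = -V := by
    rw [← hV, tripleProduct_eq, tripleProduct_eq]; simp only [PiLp.sub_apply]; ring
  have hV4 : tripleProduct (P 1) (P 0) (P 2) (P 3) = V := by
    rw [← hV, tripleProduct_eq, tripleProduct_eq]; simp only [PiLp.sub_apply]; ring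
  have hV0' : -V ≠ 0 := neg_ne_zero.mpr hV0
  fin_cases n
  · exact absurd rfl hn0
  · refine (hasDerivAt_sign_mul_dihedral hm 0 2 1 3 rfl rfl hP h01.symm h23 hV hV0 hm0
      hm5).congr_deriv ?_
    simp [lateralDeriv, tetDist]
  · have h := (hasDerivAt_sign_mul_dihedral hm 0 3 1 2 rfl rfl hP h01.symm h23.symm hV2 hV0' hm0
      hm5).neg
    refine (h.congr_of_eventuallyEq (Filter.Eventually.of_forall fun s => ?_)).congr_deriv ?_
    · change _ = -(_ * _)
      rw [hs, neg_mul]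
      rfl
    · rw [faceCoeff_swap h23]
      simp [lateralDeriv, tetDist, div_neg]
      ring
  · have h := (hasDerivAt_sign_mul_dihedral hm 1 2 0 3 rfl rfl hP h01 h23 hV3 hV0' hm0 hm5).neg
    refine (h.congr_of_eventuallyEq (Filter.Eventually.of_forall fun s => ?_)).congr_deriv ?_
    · change _ = -(_ * _)
      rw [hs, neg_mul]
      rfl
    · rw [faceCoeff_swap h01]
      simp [lateralDeriv, tetDist, div_neg]
      ring
  · refine (hasDerivAt_sign_mul_dihedral hm 1 3 0 2 rfl rfl hP h01 h23.symm hV4 hV0 hm0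
      hm5).congr_deriv ?_
    rw [faceCoeff_swap h23, faceCoeff_swap h01]
    change m t 4 * _ = m t 4 * _
    congr 1
    simp [lateralDeriv, tetDist]
    ring
  · exact absurd rfl hn5

/-- The two faces at C₀ and C₁ enter with opposite signs, and so do the two faces containing C₀C₁.
This is what lets the face terms cancel over the whole triangulation. -/
theorem sum_mul_lateralDeriv (V : ℝ) (P : Fin 4 → Space) (χ ξ : Fin 6 → ℝ) :
    ∑ n, χ n * lateralDeriv V P ξ n =
      (χ 1 - χ 2 - χ 3 + χ 4) * (ξ 1 - ξ 2 - ξ 3 + ξ 4) / V +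
      (faceForm (P 0) (P 2) (P 3) (χ 1) (χ 2) (ξ 1) (ξ 2) -
        faceForm (P 1) (P 2) (P 3) (χ 3) (χ 4) (ξ 3) (ξ 4)) +
      (faceForm (P 2) (P 0) (P 1) (χ 1) (χ 3) (ξ 1) (ξ 3) -
        faceForm (P 3) (P 0) (P 1) (χ 2) (χ 4) (ξ 2) (ξ 4)) := by
  simp only [Fin.sum_univ_six, lateralDeriv, faceForm, Matrix.cons_val]
  ring

/-! ### The developing map -/

section Developing

variable {p q : ℕ}

theorem edgePath_b_zero : edgePath q (Edge.b (0 : ZMod p)) = 1 :=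
  PresentedGroup.one_of_mem (rels := relators p q) (Or.inl rfl)

theorem edgePath_mul_of_face (i : ZMod p) (m : Fin 4) :
    edgePath q (tetLabel q i (faceEdges m).1) * edgePath q (tetLabel q i (faceEdges m).2.1) =
      edgePath q (tetLabel q i (faceEdges m).2.2) := by
  have h := PresentedGroup.one_of_mem (rels := relators p q) (Or.inr ⟨i, m, rfl⟩)
  simp only [map_mul, map_inv, mul_inv_eq_one] at h
  exact h

theorem edgePath_b_add_one (i : ZMod p) :
    edgePath q (Edge.b (i + 1)) = edgePath q (Edge.b i) * edgePath q Edge.a :=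
  (edgePath_mul_of_face i 2).symm

theorem edgePath_c_mul (i : ZMod p) :
    edgePath q Edge.c * edgePath q (Edge.b (i - (q : ZMod p))) = edgePath q (Edge.b i) :=
  edgePath_mul_of_face i 0

theorem edgePath_b_natCast (n : ℕ) :
    edgePath q (Edge.b (n : ZMod p)) = edgePath q Edge.a ^ n := by
  induction n with
  | zero => rw [Nat.cast_zero, edgePath_b_zero, pow_zero]
  | succ n ih => rw [Nat.cast_succ, edgePath_b_add_one, ih, pow_succ]

/-- The face C₀C₁B_q gives c·b₀ = b_q, and b₀ is trivial. Thus the class of a determines all other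
edge classes. -/
theorem edgePath_c : edgePath q (Edge.c : Edge p) = edgePath q Edge.a ^ q := by
  have h := edgePath_c_mul (q := q) (q : ZMod p)
  rwa [sub_self, edgePath_b_zero, mul_one, edgePath_b_natCast] at h

end Developing

theorem rotZ_apply_zero (t : ℝ) (P : Space) : rotZ t P 0 = cos t * P 0 - sin t * P 1 := rfl

theorem rotZ_apply_one (t : ℝ) (P : Space) : rotZ t P 1 = sin t * P 0 + cos t * P 1 := rfl

theorem rotZ_apply_two (t : ℝ) (P : Space) : rotZ t P 2 = P 2 := rfl

theorem dot3_rotZ (t : ℝ) (X Y X' Y' : Space) :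
    dot3 (rotZ t Y - rotZ t X) (rotZ t Y' - rotZ t X') = dot3 (Y - X) (Y' - X') := by
  simp only [dot3, PiLp.sub_apply, rotZ_apply_zero, rotZ_apply_one, rotZ_apply_two]
  linear_combination ((Y 0 - X 0) * (Y' 0 - X' 0) + (Y 1 - X 1) * (Y' 1 - X' 1)) *
    sin_sq_add_cos_sq t

theorem cross2_rotZ (t : ℝ) (X Y X' Y' : Space) :
    cross2 (rotZ t Y - rotZ t X) (rotZ t Y' - rotZ t X') = cross2 (Y - X) (Y' - X') := by
  simp only [cross2, PiLp.sub_apply, rotZ_apply_zero, rotZ_apply_one]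
  linear_combination ((Y 0 - X 0) * (Y' 1 - X' 1) - (Y 1 - X 1) * (Y' 0 - X' 0)) *
    sin_sq_add_cos_sq t

theorem faceForm_rotZ (t : ℝ) (X Y Y' : Space) :
    faceForm (rotZ t X) (rotZ t Y) (rotZ t Y') = faceForm X Y Y' := by
  have hn : (rotZ t Y' - rotZ t Y) 0 ^ 2 + (rotZ t Y' - rotZ t Y) 1 ^ 2 =
      (Y' - Y) 0 ^ 2 + (Y' - Y) 1 ^ 2 := by
    simp only [PiLp.sub_apply, rotZ_apply_zero, rotZ_apply_one]
    linear_combination ((Y' 0 - Y 0) ^ 2 + (Y' 1 - Y 1) ^ 2) * sin_sq_add_cos_sq t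
  have h2 : (rotZ t Y - rotZ t X) 2 = (Y - X) 2 := rfl
  ext a b a' b'
  simp only [faceForm, faceCoeff, projRatio, dot3_rotZ, cross2_rotZ, hn, h2]

/-! ### The matrix `F` at the lateral edges -/

section MatF

variable {p q : ℕ} {φ : Pi1 p q →* E3} {θ : ℝ}

theorem map_edgePath_b [NeZero p] (hφ : φ (edgePath q Edge.a) = rotZ θ) (i : ZMod p) :
    φ (edgePath q (Edge.b i)) = rotZ (i.val * θ) := by
  have h := edgePath_b_natCast (p := p) (q := q) i.val
  rw [ZMod.natCast_val, ZMod.cast_id] at h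
  rw [h, map_pow, hφ, rotZ_pow]

theorem map_edgePath_c (hφ : φ (edgePath q Edge.a) = rotZ θ) :
    φ (edgePath q Edge.c) = rotZ (q * θ) := by
  rw [edgePath_c, map_pow, hφ, rotZ_pow]

/-- The images of the rim vertices. -/
def rimPoint (φ : Pi1 p q →* E3) (x : Param) (i : ZMod p) : Space :=
  develop φ x (edgePath q (Edge.b i)) Vtx.B

theorem rotZ_rimPoint (hφ : φ (edgePath q Edge.a) = rotZ θ) (x : Param) (i : ZMod p) :
    rotZ (q * θ) (rimPoint φ x (i - (q : ZMod p))) = rimPoint φ x i := by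
  rw [rimPoint, rimPoint, develop, develop, ← edgePath_c_mul i, map_mul, map_edgePath_c hφ]
  rfl

theorem tetPoint_one (hφ : φ (edgePath q Edge.a) = rotZ θ) (x : Param) (i : ZMod p) :
    tetPoint φ x i 1 = rotZ (q * θ) (basePoint x Vtx.C) := by
  change develop φ x (edgePath q Edge.c) Vtx.C = _
  rw [develop, map_edgePath_c hφ]

theorem tetPoint_zero (x : Param) (i : ZMod p) : tetPoint φ x i 0 = basePoint x Vtx.C := by
  change develop φ x 1 Vtx.C = _
  rw [develop, map_one]
  rfl

theorem rimPoint_two [NeZero p] (hφ : φ (edgePath q Edge.a) = rotZ θ) (x : Param) (i : ZMod p) :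
    rimPoint φ x i 2 = 0 := by
  rw [rimPoint, develop, map_edgePath_b hφ, rotZ_apply_two]
  rfl

/-- The derivatives of the defect angles at the edges `b_j`. -/
theorem matF_b_b [NeZero p] (hφ : φ (edgePath q Edge.a) = rotZ θ) {x : Param}
    (hV : ∀ i, sixVolume φ x i ≠ 0) (j j' : ZMod p) :
    matF φ x (Edge.b j) (Edge.b j') =
      -∑ i, lateral q i j * lateral q i j' / sixVolume φ x i := by
  set l := edgeLength φ x with hl
  -- Indicators are needed because b_k may occur more than once in a tetrahedron: for q = 1 both
  -- C₀B_i and C₁B_{i+1} belong to b_i.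
  let χ : ZMod p → ZMod p → Fin 6 → ℝ := fun k i n => if tetLabel q i n = Edge.b k then 1 else 0
  have hχ : ∀ k i, χ k i 1 = (if i = k then 1 else 0) ∧ χ k i 2 = (if i + 1 = k then 1 else 0) ∧
      χ k i 3 = (if i - q = k then 1 else 0) ∧ χ k i 4 = (if i + 1 - q = k then 1 else 0) := by
    intro k i
    simp [χ, tetLabel, tetEdge, edgeClass]
  have hl0 : ∀ k, l (Edge.b k) ≠ 0 := by
    intro k h
    apply hV k
    have h0 : tetPoint φ x k 0 = tetPoint φ x k 2 := dist_eq_zero.mp h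
    rw [sixVolume, tripleProduct_eq, h0]
    simp
  have hdi : ∀ i n, HasDerivAt (fun t => if tetLabel q i n = Edge.b j then
      Real.sign (sixVolume φ x i) *
        dihedralAt (fun k => Function.update l (Edge.b j') t (tetLabel q i k)) n else 0)
      (l (Edge.b j) * l (Edge.b j') *
        (χ j i n * lateralDeriv (sixVolume φ x i) (tetPoint φ x i) (χ j' i) n))
      (l (Edge.b j')) := by
    intro i n
    by_cases hn : tetLabel q i n = Edge.b j
    · simp only [hn, if_true]
      have hm : ∀ k, HasDerivAt (fun t => Function.update l (Edge.b j') t (tetLabel q i k))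
          (χ j' i k) (l (Edge.b j')) := by
        intro k
        by_cases hk : tetLabel q i k = Edge.b j'
        · simp only [hk, Function.update_self, χ, if_true]
          exact hasDerivAt_id _
        · simp only [Function.update_of_ne hk, χ, hk, if_false]
          exact hasDerivAt_const _ _
      have h := hasDerivAt_dihedralAt (P := tetPoint φ x i) (V := sixVolume φ x i) hm
        (fun u v => by rw [Function.update_eq_self]; exact dist_tetPoint φ x i u v)
        (by rw [tetPoint_zero, tetPoint_one hφ, rotZ_apply_two])
        ((rimPoint_two hφ x i).trans (rimPoint_two hφ x (i + 1)).symm) rfl (hV i)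
        (by simp [χ, tetLabel, tetEdge, edgeClass]) (by simp [χ, tetLabel, tetEdge, edgeClass])
        (n := n) (by rintro rfl; simp [tetLabel, tetEdge, edgeClass] at hn)
        (by rintro rfl; simp [tetLabel, tetEdge, edgeClass] at hn)
      refine h.congr_deriv ?_
      have hξ : (fun k => Function.update l (Edge.b j') (l (Edge.b j')) (tetLabel q i k) *
          χ j' i k) = fun k => l (Edge.b j') * χ j' i k := by
        ext k
        rw [Function.update_eq_self]
        by_cases hk : tetLabel q i k = Edge.b j'
        · rw [hk]
        · simp [χ, hk]
      have hlin : ∀ c : ℝ, ∀ ξ : Fin 6 → ℝ,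
          lateralDeriv (sixVolume φ x i) (tetPoint φ x i) (fun k => c * ξ k) n =
            c * lateralDeriv (sixVolume φ x i) (tetPoint φ x i) ξ n := by
        intro c ξ
        fin_cases n <;> simp [lateralDeriv] <;> ring
      rw [hξ, hlin, Function.update_eq_self, hn]
      simp only [χ, hn, if_true]
      ring
    · simp only [hn, if_false, χ]
      exact (hasDerivAt_const _ _).congr_deriv (by ring)
  have hder : HasDerivAt (fun t => defect q (fun i => Real.sign (sixVolume φ x i))
      (Function.update l (Edge.b j') t) (Edge.b j)) _ (l (Edge.b j')) :=
    (HasDerivAt.fun_sum fun i _ => HasDerivAt.fun_sum fun n _ => hdi i n).fun_neg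
  rw [matF, Matrix.of_apply, hder.deriv]
  simp only [← Finset.mul_sum, sum_mul_lateralDeriv]
  rw [← hl, mul_neg, ← mul_assoc, one_div_mul_cancel (mul_ne_zero (hl0 _) (hl0 _)), one_mul]
  congr 1
  rw [Finset.sum_add_distrib, Finset.sum_add_distrib, Finset.sum_sub_distrib,
    Finset.sum_sub_distrib]
  let up : ZMod p → ℝ := fun i => faceForm (basePoint x Vtx.C) (rimPoint φ x i)
    (rimPoint φ x (i + 1)) (if i = j then 1 else 0) (if i + 1 = j then 1 else 0)
    (if i = j' then 1 else 0) (if i + 1 = j' then 1 else 0)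
  have hup : ∀ i, faceForm (tetPoint φ x i 0) (tetPoint φ x i 2) (tetPoint φ x i 3) (χ j i 1)
      (χ j i 2) (χ j' i 1) (χ j' i 2) = up i := by
    intro i
    rw [(hχ j i).1, (hχ j i).2.1, (hχ j' i).1, (hχ j' i).2.1, tetPoint_zero]
    rfl
  -- The rotation through qθ carries the upper face of index i - q to the lower face of index i to
  -- which it is glued.
  have hlow : ∀ i, faceForm (tetPoint φ x i 1) (tetPoint φ x i 2) (tetPoint φ x i 3) (χ j i 3)
      (χ j i 4) (χ j' i 3) (χ j' i 4) = up (i - q) := by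
    intro i
    rw [(hχ j i).2.2.1, (hχ j i).2.2.2, (hχ j' i).2.2.1, (hχ j' i).2.2.2, tetPoint_one hφ]
    change faceForm _ (rimPoint φ x i) (rimPoint φ x (i + 1)) _ _ _ _ = _
    rw [← rotZ_rimPoint hφ x i, ← rotZ_rimPoint hφ x (i + 1), faceForm_rotZ]
    simp only [up, sub_add_eq_add_sub]
  let sd : ZMod p → ℝ := fun i => faceForm (rimPoint φ x i) (basePoint x Vtx.C)
    (rotZ (q * θ) (basePoint x Vtx.C)) (if i = j then 1 else 0) (if i - q = j then 1 else 0)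
    (if i = j' then 1 else 0) (if i - q = j' then 1 else 0)
  have hs1 : ∀ i, faceForm (tetPoint φ x i 2) (tetPoint φ x i 0) (tetPoint φ x i 1) (χ j i 1)
      (χ j i 3) (χ j' i 1) (χ j' i 3) = sd i := by
    intro i
    rw [(hχ j i).1, (hχ j i).2.2.1, (hχ j' i).1, (hχ j' i).2.2.1, tetPoint_zero, tetPoint_one hφ]
    rfl
  have hs2 : ∀ i, faceForm (tetPoint φ x i 3) (tetPoint φ x i 0) (tetPoint φ x i 1) (χ j i 2)
      (χ j i 4) (χ j' i 2) (χ j' i 4) = sd (i + 1) := by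
    intro i
    rw [(hχ j i).2.1, (hχ j i).2.2.2, (hχ j' i).2.1, (hχ j' i).2.2.2, tetPoint_zero,
      tetPoint_one hφ]
    rfl
  simp only [hup, hlow, hs1, hs2]
  -- Glued faces cancel through the shift by q, and faces C₀C₁B_i shared by neighbouring tetrahedra
  -- through the shift by 1.
  have h1 : ∑ i, up (i - q) = ∑ i, up i := (Equiv.subRight (q : ZMod p)).sum_comp up
  have h2 : ∑ i, sd (i + 1) = ∑ i, sd i := Equiv.sum_comp (Equiv.addRight (1 : ZMod p)) sd
  rw [h1, h2, sub_self, sub_self, add_zero, add_zero]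
  refine Finset.sum_congr rfl fun i _ => ?_
  obtain ⟨a1, a2, a3, a4⟩ := hχ j i
  obtain ⟨b1, b2, b3, b4⟩ := hχ j' i
  rw [a1, a2, a3, a4, b1, b2, b3, b4]
  rfl

end MatF

/-! ### Volumes and the determinant of `F|_𝒞` -/

section Volume

variable {p q : ℕ} {φ : Pi1 p q →* E3} {θ : ℝ}

theorem sixVolume_eq_mul_cross2 [NeZero p] (hφ : φ (edgePath q Edge.a) = rotZ θ) (x : Param)
    (i : ZMod p) :
    sixVolume φ x i = -x 2 * cross2 (rotZ (q * θ) (basePoint x Vtx.C) - basePoint x Vtx.C)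
      (rimPoint φ x (i + 1) - rimPoint φ x i) := by
  have h := tripleProduct_eq_mul_cross2 (X := tetPoint φ x i 0) (Y := tetPoint φ x i 2)
    (Z := tetPoint φ x i 1) (W := tetPoint φ x i 3)
    (by rw [tetPoint_zero, tetPoint_one hφ, rotZ_apply_two])
    ((rimPoint_two hφ x i).trans (rimPoint_two hφ x (i + 1)).symm)
  have h2 : (tetPoint φ x i 2 - tetPoint φ x i 0) 2 = -x 2 := by
    rw [tetPoint_zero]
    change rimPoint φ x i 2 - x 2 = _
    rw [rimPoint_two hφ, zero_sub]
  rw [h2, tetPoint_one hφ, tetPoint_zero] at h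
  rw [sixVolume, tetPoint_one hφ, tetPoint_zero]
  exact h

/-- The horizontal cross product of C₁ - C₀ and B_{i+1} - B_i expands into four terms. The rotation
through qθ takes C₀, B_{j-q} to C₁, B_j, so the terms with C₁ are those with C₀ at shifted indices.
-/
theorem sixVolume_eq_mulVec [NeZero p] (hφ : φ (edgePath q Edge.a) = rotZ θ) (x : Param)
    (i : ZMod p) :
    sixVolume φ x i = -x 2 * (lateralMatrix p q).mulVec
      (fun j => cross2 (basePoint x Vtx.C) (rimPoint φ x j)) i := by
  have hrot : ∀ j, cross2 (basePoint x Vtx.C) (rimPoint φ x (j - q)) =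
      cross2 (rotZ (q * θ) (basePoint x Vtx.C)) (rimPoint φ x j) := by
    intro j
    rw [← rotZ_rimPoint hφ x j]
    simp only [cross2, rotZ_apply_zero, rotZ_apply_one]
    linear_combination -(basePoint x Vtx.C 0 * rimPoint φ x (j - q) 1 -
      basePoint x Vtx.C 1 * rimPoint φ x (j - q) 0) * sin_sq_add_cos_sq (q * θ)
  rw [lateralMatrix_mulVec, hrot, hrot, sixVolume_eq_mul_cross2 hφ]
  simp only [cross2, PiLp.sub_apply]
  ring

theorem cross2_eq_sin (x : Param) (i : ZMod p) {τ : ℝ} (h : φ (edgePath q (Edge.b i)) = rotZ τ) :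
    cross2 (basePoint x Vtx.C) (rimPoint φ x i) = x 0 * x 1 * sin (τ - x 3) := by
  rw [rimPoint, develop, h, sin_sub]
  simp only [cross2, rotZ_apply_zero, rotZ_apply_one]
  simp [basePoint]
  ring

theorem map_edgePath_b_zero : φ (edgePath q (Edge.b 0)) = rotZ 0 := by
  rw [edgePath_b_zero, map_one]
  ext1 P
  exact (rotZFun_zero P).symm

/-- The relation b₋₁·a = b₀ = 1 gives the angle -θ directly, in place of (p-1)θ from the
representative of -1. -/
theorem map_edgePath_b_neg_one (hφ : φ (edgePath q Edge.a) = rotZ θ) :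
    φ (edgePath q (Edge.b (-1))) = rotZ (-θ) := by
  have h := edgePath_b_add_one (q := q) (-1 : ZMod p)
  rw [neg_add_cancel, edgePath_b_zero] at h
  rw [eq_inv_of_mul_eq_one_left h.symm, map_inv, hφ]
  refine inv_eq_of_mul_eq_one_left ?_
  ext1 P
  change rotZFun (-θ) (rotZFun θ P) = P
  rw [rotZFun_rotZFun, neg_add_cancel, rotZFun_zero]

theorem cross2_zero_sub_cross2_neg_one (hφ : φ (edgePath q Edge.a) = rotZ θ) (x : Param) :
    cross2 (basePoint x Vtx.C) (rimPoint φ x 0) - cross2 (basePoint x Vtx.C) (rimPoint φ x (-1)) =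
      x 0 * x 1 * (sin (x 3 + θ) - sin (x 3)) := by
  rw [cross2_eq_sin x _ map_edgePath_b_zero, cross2_eq_sin x _ (map_edgePath_b_neg_one hφ),
    zero_sub, sin_neg, show -θ - x 3 = -(x 3 + θ) by ring, sin_neg]
  ring

/-- The product of `det F|_𝒞` and the volumes of all tetrahedra. -/
theorem exists_detFC_mul_prod_sixVolume [NeZero p] (hp : 2 ≤ p) (hpq : p.Coprime q)
    (hφ : φ (edgePath q Edge.a) = rotZ θ) :
    ∃ c : ℝ, 0 < c ∧ ∀ x : Param, (∀ i, sixVolume φ x i ≠ 0) →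
      |detFC φ x * ∏ i, sixVolume φ x i| =
        c * (x 2 * (x 0 * x 1 * (sin (x 3 + θ) - sin (x 3)))) ^ 2 := by
  obtain ⟨c, hc, h⟩ := exists_det_innerMatrix hp hpq
  refine ⟨c, hc, fun x hV => ?_⟩
  have h1 := h (fun j => cross2 (basePoint x Vtx.C) (rimPoint φ x j)) (sixVolume φ x) (-x 2)
    (sixVolume_eq_mulVec hφ x) hV
  have h2 : (matF φ x).submatrix setC setC = -((innerMatrix p q).transpose *
      (Matrix.diagonal (sixVolume φ x)⁻¹ * innerMatrix p q)) := by
    ext m n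
    change matF φ x (Edge.b (innerIndex m)) (Edge.b (innerIndex n)) = _
    rw [matF_b_b hφ hV, Matrix.neg_apply, Matrix.mul_apply]
    congr 1
    refine Finset.sum_congr rfl fun i _ => ?_
    rw [Matrix.diagonal_mul, Matrix.transpose_apply]
    simp only [innerMatrix, lateralMatrix, Matrix.submatrix_apply, Matrix.of_apply, id,
      Pi.inv_apply]
    ring
  rw [detFC, h2, Matrix.det_neg, mul_assoc, h1, cross2_zero_sub_cross2_neg_one hφ, abs_mul, abs_pow,
    abs_neg, abs_one, one_pow, one_mul, abs_neg, abs_of_nonneg (by positivity)]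
  ring

end Volume

/-! ### The edge lengths as functions of the parameters -/

/-- This is l dl = d(l²)/2; the squared lengths are polynomials in the coordinates and in sines and
cosines. -/
theorem smul_fderiv_eq_of_sq_eq {E : Type*} [NormedAddCommGroup E] [NormedSpace ℝ E] {f g : E → ℝ}
    {g' : E →L[ℝ] ℝ} {x : E} (hf : ∀ y, 0 ≤ f y) (hfg : ∀ y, f y ^ 2 = g y) (hx : f x ≠ 0)
    (hg : HasFDerivAt g g' x) : f x • fderiv ℝ f x = (2 : ℝ)⁻¹ • g' := by
  have hfe : f = fun y => √(g y) := by
    ext y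
    rw [← hfg, Real.sqrt_sq (hf y)]
  have hgx : g x ≠ 0 := by rw [← hfg]; exact pow_ne_zero 2 hx
  have h := hg.sqrt hgx
  rw [← hfe] at h
  have hx2 : √(g x) = f x := by rw [← hfg, Real.sqrt_sq (hf x)]
  rw [h.fderiv, smul_smul, hx2]
  congr 1
  field_simp

section Lengths

variable {p q : ℕ} {φ : Pi1 p q →* E3}

theorem edgeLength_sq (x : Param) {e : Edge p} {τ : ℝ} (h : φ (edgePath q e) = rotZ τ) :
    edgeLength φ x e ^ 2 = dot3 (rotZ τ (basePoint x e.tgt) - basePoint x e.src)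
      (rotZ τ (basePoint x e.tgt) - basePoint x e.src) := by
  rw [edgeLength, dist_sq_eq_dot3, develop, develop, h, map_one]
  rfl

theorem edgeLength_a_sq (x : Param) {τ : ℝ} (h : φ (edgePath q Edge.a) = rotZ τ) :
    edgeLength φ x Edge.a ^ 2 = 2 * (1 - cos τ) * x 0 ^ 2 := by
  rw [edgeLength_sq x h]
  simp only [dot3, PiLp.sub_apply, rotZ_apply_zero, rotZ_apply_one, rotZ_apply_two]
  simp [basePoint, Edge.src, Edge.tgt]
  linear_combination x 0 ^ 2 * sin_sq_add_cos_sq τ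

theorem edgeLength_c_sq (x : Param) {τ : ℝ} (h : φ (edgePath q Edge.c) = rotZ τ) :
    edgeLength φ x Edge.c ^ 2 = 2 * (1 - cos τ) * x 1 ^ 2 := by
  rw [edgeLength_sq x h]
  simp only [dot3, PiLp.sub_apply, rotZ_apply_zero, rotZ_apply_one, rotZ_apply_two]
  simp [basePoint, Edge.src, Edge.tgt]
  linear_combination x 1 ^ 2 * (sin (x 3) ^ 2 + cos (x 3) ^ 2) * sin_sq_add_cos_sq τ +
    x 1 ^ 2 * (2 - 2 * cos τ) * sin_sq_add_cos_sq (x 3)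

theorem edgeLength_b_sq (x : Param) {j : ZMod p} {τ : ℝ}
    (h : φ (edgePath q (Edge.b j)) = rotZ τ) :
    edgeLength φ x (Edge.b j) ^ 2 =
      x 0 ^ 2 + x 1 ^ 2 + x 2 ^ 2 - 2 * (x 0 * x 1 * cos (x 3 - τ)) := by
  rw [edgeLength_sq x h, cos_sub]
  simp only [dot3, PiLp.sub_apply, rotZ_apply_zero, rotZ_apply_one, rotZ_apply_two]
  simp [basePoint, Edge.src, Edge.tgt]
  linear_combination x 0 ^ 2 * sin_sq_add_cos_sq τ + x 1 ^ 2 * sin_sq_add_cos_sq (x 3)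

theorem lengthForm_eq {x : Param} {e : Edge p} (hx : edgeLength φ x e ≠ 0) {g : Param → ℝ}
    {g' : Param →L[ℝ] ℝ} (hg : ∀ y, edgeLength φ y e ^ 2 = g y) (hg' : HasFDerivAt g g' x)
    (u : Param) : lengthForm φ x e u = 2⁻¹ * g' u := by
  have h := smul_fderiv_eq_of_sq_eq (f := fun y => edgeLength φ y e) (fun y => dist_nonneg) hg hx
    hg'
  exact congrArg (fun L : Param →L[ℝ] ℝ => L u) h

theorem hasFDerivAt_coord (x : Param) (n : Fin 4) :
    HasFDerivAt (fun y : Param => y n) (ContinuousLinearMap.proj (R := ℝ) n) x :=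
  hasFDerivAt_apply n x

theorem lengthForm_a {x : Param} (hx : edgeLength φ x Edge.a ≠ 0) {τ : ℝ}
    (h : φ (edgePath q Edge.a) = rotZ τ) (u : Param) :
    lengthForm φ x Edge.a u = 2 * (1 - cos τ) * x 0 * u 0 := by
  rw [lengthForm_eq hx (fun y => edgeLength_a_sq y h)
    (((hasFDerivAt_coord x 0).pow 2).const_mul (2 * (1 - cos τ)))]
  simp
  ring

theorem lengthForm_c {x : Param} (hx : edgeLength φ x Edge.c ≠ 0) {τ : ℝ}
    (h : φ (edgePath q Edge.c) = rotZ τ) (u : Param) :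
    lengthForm φ x Edge.c u = 2 * (1 - cos τ) * x 1 * u 1 := by
  rw [lengthForm_eq hx (fun y => edgeLength_c_sq y h)
    (((hasFDerivAt_coord x 1).pow 2).const_mul (2 * (1 - cos τ)))]
  simp
  ring

theorem lengthForm_b {x : Param} {j : ZMod p} (hx : edgeLength φ x (Edge.b j) ≠ 0) {τ : ℝ}
    (h : φ (edgePath q (Edge.b j)) = rotZ τ) (u : Param) :
    lengthForm φ x (Edge.b j) u = (x 0 - x 1 * cos (x 3 - τ)) * u 0 +
      (x 1 - x 0 * cos (x 3 - τ)) * u 1 + x 2 * u 2 + x 0 * x 1 * sin (x 3 - τ) * u 3 := by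
  have h0 := hasFDerivAt_coord x 0
  have h1 := hasFDerivAt_coord x 1
  rw [lengthForm_eq hx (fun y => edgeLength_b_sq y h)
    ((((h0.pow 2).add (h1.pow 2)).add ((hasFDerivAt_coord x 2).pow 2)).sub
      (((h0.mul h1).mul ((hasFDerivAt_coord x 3).sub_const τ).cos).const_mul 2))]
  simp
  ring

end Lengths

/-! ### Forms of top degree in coordinates. -/

theorem wedge_eq_det_mul_det {n : ℕ} (θ : Fin n → (Fin n → ℝ) →ₗ[ℝ] ℝ)
    (T : Matrix (Fin n) (Fin n) ℝ) (h : ∀ j u, θ j u = ∑ k, T j k * u k) (v : Fin n → Fin n → ℝ) :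
    wedge θ v = (Matrix.of v).det * T.det := by
  rw [← Matrix.det_transpose T, ← Matrix.det_mul]
  change Matrix.det (fun i => LinearMap.pi θ (v i)) = _
  congr 1
  ext i j
  rw [LinearMap.pi_apply, h, Matrix.mul_apply]
  exact Finset.sum_congr rfl fun k _ => mul_comm _ _

theorem cylForm_eq (x : Param) (v : Fin 4 → Param) :
    cylForm x v = (Matrix.of v).det * (x 0 * x 1) := by
  rw [cylForm, wedge_eq_det_mul_det _ (Matrix.diagonal ![x 0, x 1, 1, 1]), Matrix.det_diagonal]
  · simp [Fin.prod_univ_four]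
  · intro j u
    fin_cases j <;> simp [Matrix.diagonal_apply]

/-! ### The differential form and its domain -/

section Form

variable {p q : ℕ} {φ : Pi1 p q →* E3} {θ : ℝ}

/-- The rows for a and c contain only dρ and dσ. Hence only s ds + ρσ sin α dα and s ds + ρσ
sin(α+θ) dα matter in the rows for b₀ and b_{p-1}. -/
theorem wedge_lengthForm (hφ : φ (edgePath q Edge.a) = rotZ θ) {x : Param}
    (hx : ∀ n, edgeLength φ x (setCBar n) ≠ 0) (v : Fin 4 → Param) :
    wedge (fun n => lengthForm φ x (setCBar n)) v =
      4 * (1 - cos θ) * (1 - cos (q * θ)) * (x 2 * (x 0 * x 1 * (sin (x 3 + θ) - sin (x 3)))) *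
        cylForm x v := by
  have hcb : (setCBar 2 : Edge p) = Edge.b (-1) := by simp [setCBar]
  let T : Matrix (Fin 4) (Fin 4) ℝ :=
    !![2 * (1 - cos θ) * x 0, 0, 0, 0;
      x 0 - x 1 * cos (x 3 - 0), x 1 - x 0 * cos (x 3 - 0), x 2, x 0 * x 1 * sin (x 3 - 0);
      x 0 - x 1 * cos (x 3 - -θ), x 1 - x 0 * cos (x 3 - -θ), x 2, x 0 * x 1 * sin (x 3 - -θ);
      0, 2 * (1 - cos (q * θ)) * x 1, 0, 0]
  have hT : ∀ j u, lengthForm φ x (setCBar j) u = ∑ k, T j k * u k := by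
    intro j u
    rw [Fin.sum_univ_four]
    fin_cases j
    · refine (lengthForm_a (hx 0) hφ u).trans ?_
      simp [T]
    · refine (lengthForm_b (hx 1) map_edgePath_b_zero u).trans ?_
      simp [T]
    · have hx2 := hx 2
      rw [hcb] at hx2
      change lengthForm φ x (setCBar 2) u = _
      rw [hcb]
      refine (lengthForm_b hx2 (map_edgePath_b_neg_one hφ) u).trans ?_
      simp [T]
    · refine (lengthForm_c (hx 3) (map_edgePath_c hφ) u).trans ?_
      simp [T]
  rw [wedge_eq_det_mul_det _ T hT, cylForm_eq]
  have hdet : T.det = 4 * (1 - cos θ) * (1 - cos (q * θ)) *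
      (x 2 * (x 0 * x 1 * (sin (x 3 + θ) - sin (x 3)))) * (x 0 * x 1) := by
    simp only [T, Matrix.det_succ_row_zero, Fin.sum_univ_succ, sub_zero, sub_neg_eq_add]
    simp [Fin.succAbove]
    ring
  rw [hdet]
  ring

theorem edgeLength_setCBar_ne_zero [NeZero p] (hφ : φ (edgePath q Edge.a) = rotZ θ) (hθ : cos θ ≠ 1)
    (hqθ : cos (q * θ) ≠ 1) {x : Param} (hx : x ∈ formDomain φ) (n : Fin 4) :
    edgeLength φ x (setCBar n) ≠ 0 := by
  obtain ⟨h0, h1, hV, -⟩ := hx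
  have hb : ∀ k, edgeLength φ x (Edge.b k) ≠ 0 := by
    intro k h
    apply hV k
    have h0 : tetPoint φ x k 0 = tetPoint φ x k 2 := dist_eq_zero.mp h
    rw [sixVolume, tripleProduct_eq, h0]
    simp
  have ht : 1 - cos θ ≠ 0 := sub_ne_zero.mpr hθ.symm
  have hqt : 1 - cos (q * θ) ≠ 0 := sub_ne_zero.mpr hqθ.symm
  fin_cases n
  · refine fun h => ?_
    have h2 := edgeLength_a_sq x hφ
    rw [show edgeLength φ x Edge.a = 0 from h] at h2
    exact (by positivity : 2 * (1 - cos θ) * x 0 ^ 2 ≠ 0) (by rw [← h2]; norm_num)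
  · exact hb _
  · exact hb _
  · refine fun h => ?_
    have h2 := edgeLength_c_sq x (map_edgePath_c hφ)
    rw [show edgeLength φ x Edge.c = 0 from h] at h2
    exact (by positivity : 2 * (1 - cos (q * θ)) * x 1 ^ 2 ≠ 0) (by rw [← h2]; norm_num)

/-- The form is a constant multiple of `ρ dρ ∧ σ dσ ∧ ds ∧ dα`. -/
theorem exists_theForm_eq [NeZero p] (hp : 2 ≤ p) (hpq : p.Coprime q)
    (hφ : φ (edgePath q Edge.a) = rotZ θ) (hθ : cos θ ≠ 1) (hqθ : cos (q * θ) ≠ 1) :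
    ∃ I : ℝ, 0 < I ∧ ∀ x ∈ formDomain φ, ∀ v : Fin 4 → Param,
      theForm φ x v = |I * cylForm x v| := by
  obtain ⟨c, hc, hdet⟩ := exists_detFC_mul_prod_sixVolume hp hpq hφ
  have ht : 0 < 1 - cos θ := sub_pos.mpr ((cos_le_one θ).lt_of_ne hθ)
  have hqt : 0 < 1 - cos (q * θ) := sub_pos.mpr ((cos_le_one _).lt_of_ne hqθ)
  refine ⟨4 * (1 - cos θ) * (1 - cos (q * θ)) / √c, by positivity, fun x hx v => ?_⟩
  have hd := hdet x hx.2.2.1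
  have hne : detFC φ x * ∏ i, sixVolume φ x i ≠ 0 :=
    mul_ne_zero hx.2.2.2 (Finset.prod_ne_zero_iff.mpr fun i _ => hx.2.2.1 i)
  rw [theForm, wedge_lengthForm hφ (edgeLength_setCBar_ne_zero hφ hθ hqθ hx), hd,
    Real.sqrt_mul hc.le, Real.sqrt_sq_eq_abs]
  -- The same expression is a factor of the numerator and, squared, of the radicand. It is nonzero
  -- because the denominator is.
  generalize x 2 * (x 0 * x 1 * (sin (x 3 + θ) - sin (x 3))) = K at hd
  have hK : K ≠ 0 := by
    rintro rfl
    rw [zero_pow two_ne_zero, mul_zero, abs_eq_zero] at hd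
    exact hne hd
  have hK' : |K| ≠ 0 := abs_ne_zero.mpr hK
  have hsc : √c ≠ 0 := (Real.sqrt_pos.mpr hc).ne'
  simp only [abs_mul, abs_div, abs_abs]
  field_simp

/-! ### Density of the domain -/

/-- The two vectors are chords subtending qθ and θ, of signed lengths 2σ sin(qθ/2) and 2ρ sin(θ/2),
each perpendicular to the radius at its middle angle. In this form the zeros in α are visible. -/
theorem cross2_rotZ_sub (x : Param) (i : ZMod p) {τ : ℝ}
    (hφ : φ (edgePath q Edge.a) = rotZ θ) (h : φ (edgePath q (Edge.b i)) = rotZ τ) :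
    cross2 (rotZ (q * θ) (basePoint x Vtx.C) - basePoint x Vtx.C)
      (rimPoint φ x (i + 1) - rimPoint φ x i) =
      4 * sin (θ / 2) * sin (q * θ / 2) * (x 0 * x 1 * sin (τ + θ / 2 - q * θ / 2 - x 3)) := by
  have hi1 : rimPoint φ x (i + 1) = rotZ (τ + θ) (basePoint x Vtx.B) := by
    rw [rimPoint, develop, edgePath_b_add_one, map_mul, h, hφ]
    exact rotZFun_rotZFun _ _ _
  have hi0 : rimPoint φ x i = rotZ τ (basePoint x Vtx.B) := by rw [rimPoint, develop, h]
  rw [hi1, hi0]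
  generalize hg : q * θ / 2 = g
  generalize hh : θ / 2 = h
  generalize hβ : τ + h - g - x 3 = β
  have e1 : (q : ℝ) * θ = 2 * g := by linarith
  have e2 : θ = 2 * h := by linarith
  have e3 : cross2 (rotZ (q * θ) (basePoint x Vtx.C) - basePoint x Vtx.C)
      (rotZ (τ + θ) (basePoint x Vtx.B) - rotZ τ (basePoint x Vtx.B)) =
      x 0 * x 1 * (sin (τ + θ - (x 3 + q * θ)) - sin (τ - (x 3 + q * θ)) - sin (τ + θ - x 3) +
        sin (τ - x 3)) := by
    simp only [cross2, PiLp.sub_apply, rotZ_apply_zero, rotZ_apply_one, sin_sub _ (x 3),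
      sin_sub _ (x 3 + q * θ), sin_add (x 3), cos_add (x 3)]
    simp [basePoint]
    ring
  rw [e3, e1, e2, show τ + 2 * h - (x 3 + 2 * g) = β + h - g by rw [← hβ]; ring,
    show τ - (x 3 + 2 * g) = β - h - g by rw [← hβ]; ring,
    show τ + 2 * h - x 3 = β + h + g by rw [← hβ]; ring,
    show τ - x 3 = β - h + g by rw [← hβ]; ring]
  simp only [sin_sub, sin_add, cos_sub, cos_add]
  ring

theorem countable_setOf_sin_sub_eq_zero (β : ℝ) : {t : ℝ | sin (β - t) = 0}.Countable := by
  refine (Set.countable_range fun n : ℤ => β - n * π).mono fun t ht => ?_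
  obtain ⟨n, hn⟩ := sin_eq_zero_iff.mp ht
  exact ⟨n, by simp only; linarith⟩

theorem subset_closure_formDomain [NeZero p] (hp : 2 ≤ p) (hpq : p.Coprime q)
    (hφ : φ (edgePath q Edge.a) = rotZ θ) (hθ : cos θ ≠ 1) (hqθ : cos (q * θ) ≠ 1) :
    {x : Param | 0 < x 0 ∧ 0 < x 1} ⊆ closure (formDomain φ) := by
  rintro x ⟨hx0, hx1⟩
  obtain ⟨c, hc, hdet⟩ := exists_detFC_mul_prod_sixVolume hp hpq hφ
  have hsin : ∀ t, cos t ≠ 1 → sin (t / 2) ≠ 0 := by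
    intro t ht h
    apply ht
    have h2 := cos_two_mul (t / 2)
    have h3 := sin_sq_add_cos_sq (t / 2)
    rw [show 2 * (t / 2) = t by ring] at h2
    rw [h] at h3
    linarith
  -- The first part contains the α at which some volume vanishes, the second those with sin(α+θ) =
  -- sin α, that is cos(α + θ/2) = 0. Only s and α have to be perturbed.
  let Z : Set ℝ := (⋃ i : ZMod p, {t | sin (i.val * θ + θ / 2 - q * θ / 2 - t) = 0}) ∪
    {t | sin (π / 2 - θ / 2 - t) = 0}
  have hZ : Z.Countable := (Set.countable_iUnion fun i =>
    countable_setOf_sin_sub_eq_zero _).union (countable_setOf_sin_sub_eq_zero _)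
  have hdense : Dense (({0}ᶜ : Set ℝ) ×ˢ Zᶜ) :=
    (dense_compl_singleton 0).prod (hZ.dense_compl ℝ)
  let f : ℝ × ℝ → Param := fun y => ![x 0, x 1, y.1, y.2]
  have hf : Continuous f := by
    refine continuous_pi fun n => ?_
    fin_cases n
    · exact continuous_const
    · exact continuous_const
    · exact continuous_fst
    · exact continuous_snd
  have hfx : f (x 2, x 3) = x := by
    ext n
    fin_cases n <;> rfl
  rw [← hfx]
  refine closure_mono ?_ (mem_closure_image hf.continuousAt (hdense (x 2, x 3)))
  rintro _ ⟨⟨s, t⟩, ⟨hs, ht⟩, rfl⟩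
  have hs : s ≠ 0 := hs
  simp only [Z, Set.mem_compl_iff, Set.mem_union, Set.mem_iUnion, Set.mem_ofPred_eq, not_or,
    not_exists] at ht
  have hV : ∀ i, sixVolume φ (f (s, t)) i ≠ 0 := by
    intro i
    rw [sixVolume_eq_mul_cross2 hφ, cross2_rotZ_sub _ i hφ (map_edgePath_b hφ i)]
    exact mul_ne_zero (neg_ne_zero.mpr hs) (mul_ne_zero (mul_ne_zero
      (mul_ne_zero four_ne_zero (hsin θ hθ)) (hsin _ hqθ))
      (mul_ne_zero (mul_ne_zero hx0.ne' hx1.ne') (ht.1 i)))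
  refine ⟨hx0, hx1, hV, fun h => ?_⟩
  have hd := hdet _ hV
  rw [h, zero_mul, abs_zero] at hd
  have hdiff : sin (t + θ) - sin t = 2 * sin (θ / 2) * sin (π / 2 - θ / 2 - t) := by
    rw [sin_sub_sin, sub_sub, sin_pi_div_two_sub]
    ring_nf
  have hne : s * (x 0 * x 1 * (sin (t + θ) - sin t)) ≠ 0 := by
    rw [hdiff]
    exact mul_ne_zero hs (mul_ne_zero (mul_ne_zero hx0.ne' hx1.ne')
      (mul_ne_zero (mul_ne_zero two_ne_zero (hsin θ hθ)) ht.2))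
  exact (mul_ne_zero hc.ne' (pow_ne_zero 2 hne)) hd.symm

end Form

/-! ### Nontriviality of the rotations, and the main theorem. -/

theorem cos_two_pi_mul_div_ne_one {p : ℕ} [NeZero p] {n : ℤ} (hn : ¬ (p : ℤ) ∣ n) :
    cos (2 * π * n / p) ≠ 1 := by
  rw [Ne, cos_eq_one_iff]
  rintro ⟨m, hm⟩
  have hp : (p : ℝ) ≠ 0 := Nat.cast_ne_zero.mpr (NeZero.ne p)
  have hpi := pi_ne_zero
  field_simp at hm
  exact hn ⟨m, by rw [mul_comm]; exact_mod_cast hm.symm⟩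

end LensForm

end

theorem mainTheorem1 (p q : ℕ) [NeZero p] (hp : 3 ≤ p) (hq : 0 < q) (hqp : q < p)
    (hpq : p.Coprime q) (k : ℤ) (hk : ¬ (p : ℤ) ∣ k)
    (φ : LensForm.Pi1 p q →* LensForm.E3)
    (hφ : φ (LensForm.edgePath q LensForm.Edge.a) = LensForm.rotZ (2 * Real.pi * k / p)) :
    {x : LensForm.Param | 0 < x 0 ∧ 0 < x 1} ⊆ closure (LensForm.formDomain φ) ∧
    ∃! I : ℝ, 0 < I ∧ ∀ x ∈ LensForm.formDomain φ, ∀ v : Fin 4 → LensForm.Param,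
      LensForm.theForm φ x v = |I * LensForm.cylForm x v| := by
  have hp2 : 2 ≤ p := by omega
  have hθ := LensForm.cos_two_pi_mul_div_ne_one hk
  have hqk : ¬ (p : ℤ) ∣ (q : ℤ) * k := fun h =>
    hk ((Nat.isCoprime_iff_coprime.mpr hpq).dvd_of_dvd_mul_left h)
  have hqθ : Real.cos (q * (2 * Real.pi * k / p)) ≠ 1 := by
    have h := LensForm.cos_two_pi_mul_div_ne_one hqk
    rwa [show 2 * Real.pi * ((q * k : ℤ) : ℝ) / p = q * (2 * Real.pi * k / p) by
      push_cast; ring] at h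
  have hdense := LensForm.subset_closure_formDomain hp2 hpq hφ hθ hqθ
  obtain ⟨I, hI, hform⟩ := LensForm.exists_theForm_eq hp2 hpq hφ hθ hqθ
  refine ⟨hdense, I, ⟨hI, hform⟩, ?_⟩
  rintro J ⟨hJ, hform'⟩
  obtain ⟨x, hx⟩ : (LensForm.formDomain φ).Nonempty :=
    closure_nonempty_iff.mp ⟨fun _ => 1, hdense ⟨one_pos, one_pos⟩⟩
  -- On the standard basis the cylindrical form equals ρσ > 0, so a single point of the domain
  -- determines the constant.
  let v : Fin 4 → LensForm.Param := fun i => (1 : Matrix (Fin 4) (Fin 4) ℝ) i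
  have h := (hform' x hx v).symm.trans (hform x hx v)
  have hv : (Matrix.of v).det = 1 := Matrix.det_one (n := Fin 4) (R := ℝ)
  have h1 : LensForm.cylForm x v = x 0 * x 1 := by rw [LensForm.cylForm_eq, hv, one_mul]
  have hpos : 0 < x 0 * x 1 := mul_pos hx.1 hx.2.1
  rw [h1, abs_of_pos (mul_pos hJ hpos), abs_of_pos (mul_pos hI hpos)] at h
  exact mul_right_cancel₀ hpos.ne' h
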